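/- Let $\Bbbk$ be a commutative ring. For a $\mathbb Z$-graded $\Bbbk$-quiver $\mathcal A$ let $s\mathcal A$ be its suspension, $(s\mathcal A)(X,Y)^d=\mathcal A(X,Y)^{d+1}$, and let $T\mathcal A$, $T\mathcal A(X,Y)=\bigoplus_{n\ge0}\bigoplus_{X=X_0,\dots,X_n=Y}\mathcal A(X_0,X_1)\otimes\dots\otimes\mathcal A(X_{n-1},X_n)$, be its tensor cocategory with the cut comultiplication $\Delta$, the counit $\varepsilon$ and the projections $\mathrm{pr}_n:T\mathcal A\to T^n\mathcal A$. Maps act on the right, and Koszul's rule $(x\otimes y)(f\otimes g)=(-1)^{\deg y\deg f}xf\otimes yg$ is used. A cocategory homomorphism $f$ satisfies $f\Delta=\Delta(f\otimes f)$, $f\varepsilon=\varepsilon$; an $(f,g)$-coderivation $r$ satisfies $r\Delta=\Delta(f\otimes r+r\otimes g)$. An $A_\infty$-structure on $\mathcal A$ is a $(1,1)$-coderivation $b:Ts\mathcal A\to Ts\mathcal A$ of degree $1$ with $b^2=0$ and $(T^0s\mathcal A)b=0$. An $A_\infty$-functor $f:\mathcal A\to\mathcal B$ is a cocategory homomorphism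 $Ts\mathcal A\to Ts\mathcal B$ of degree $0$ with $fb=bf$ and $(T^0s\mathcal A)f\subset T^0s\mathcal B$; an $A_\infty$-transformation $r:f\to g$ of degree $d$ is an $(f,g)$-coderivation $Ts\mathcal A\to Ts\mathcal B$ of degree $d$. Let $\mathcal A$, $\mathcal B$ be $A_\infty$-categories. Let $A_\infty(\mathcal A,\mathcal B)$ be the graded quiver whose objects are the $A_\infty$-functors $\mathcal A\to\mathcal B$ and for which $A_\infty(\mathcal A,\mathcal B)(f,g)^{d+1}$ is the module of $A_\infty$-transformations $f\to g$ of degree $d$. For $f^0\xrightarrow{r^1}f^1\to\dots\xrightarrow{r^n}f^n$ let $(r^1\otimes\dots\otimes r^n)\theta:Ts\mathcal A(X,Y)\to Ts\mathcal B(Xf^0,Yf^n)$ be the map with matrix elements $$\theta_{kl}=\sum f^0_{i^0_1}\otimes\dots\otimes f^0_{i^0_{m_0}}\otimes r^1_{j_1}\otimes f^1_{i^1_1}\otimes\dots\otimes f^1_{i^1_{m_1}}\otimes\dots\otimes r^n_{j_n}\otimes f^n_{i^n_1}\otimes\dots\otimes f^n_{i^n_{m_n}}:T^ks\mathcal A\to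 T^ls\mathcal B,$$ where $f_i=f|_{T^i}\mathrm{pr}_1$, $r_j=r|_{T^j}\mathrm{pr}_1$, and the sum is over $m_0+\dots+m_n+n=l$ and all indices of total sum $k$; for $n=0$, $()\theta=f^0$. (1) There is a unique $(1,1)$-coderivation $B:TsA_\infty(\mathcal A,\mathcal B)\to TsA_\infty(\mathcal A,\mathcal B)$ of degree $1$ such that $B_0=B|_{T^0}\mathrm{pr}_1=0$ and, for all $n\ge0$ and all composable homogeneous $r^1,\dots,r^n$, $$(r^1\otimes\dots\otimes r^n)\theta b=[(r^1\otimes\dots\otimes r^n)B]\theta+(-1)^{\deg r^1+\dots+\deg r^n}\,b(r^1\otimes\dots\otimes r^n)\theta .$$ It satisfies $B^2=0$ and is an $A_\infty$-structure on $A_\infty(\mathcal A,\mathcal B)$. (Here $\deg r^i$ is the degree in $sA_\infty(\mathcal A,\mathcal B)$, i.e. the degree of the map $r^i$.) (2) $B$ is also the unique $A_\infty$-structure on $A_\infty(\mathcal A,\mathcal B)$ for which the action $\alpha:Ts\mathcal A\otimes TsA_\infty(\mathcal A,\mathcal B)\to Ts\mathcal B$, $a\otimes r^1\otimes\dots\otimes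 r^n\mapsto a[(r^1\otimes\dots\otimes r^n)\theta]$, is an $A_\infty$-functor, that is, a homomorphism of graded cocategories of degree $0$ which maps $T^0\otimes T^0$ to $T^0$ and satisfies $\alpha b=(1\otimes B+b\otimes1)\alpha$. -/

import Mathlib

open scoped TensorProduct DirectSum

noncomputable section

namespace AInfty

universe u

/-- A `ℤ`-graded `k`-quiver: objects, and a `ℤ`-graded `k`-module (given by its homogeneous
components) for every pair of objects. -/
structure GradedQuiver (k : Type u) [CommRing k] where
  Ob : Type u
  Hom : Ob → Ob → ℤ → Type u
  [addCommGroup : ∀ X Y d, AddCommGroup (Hom X Y d)]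
  [module : ∀ X Y d, Module k (Hom X Y d)]

attribute [instance] GradedQuiver.addCommGroup GradedQuiver.module

variable {k : Type u} [CommRing k]

/-- The suspension `sA`, with `(sA)(X, Y)^d = A(X, Y)^(d+1)`. -/
abbrev GradedQuiver.susp (A : GradedQuiver k) : GradedQuiver k where
  Ob := A.Ob
  Hom X Y d := A.Hom X Y (d + 1)

/-- A sequence of objects `X = X₀, X₁, …, Xₙ = Y` together with degrees `d₁, …, dₙ`. It indexes the
summand `A(X₀,X₁)^d₁ ⊗ ⋯ ⊗ A(Xₙ₋₁,Xₙ)^dₙ` of the tensor cocategory of `A`. -/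
inductive Word (A : GradedQuiver k) : A.Ob → A.Ob → Type u
  | nil (X : A.Ob) : Word A X X
  | cons (X : A.Ob) {Y Z : A.Ob} (d : ℤ) (w : Word A Y Z) : Word A X Z

/-- `d₁ + ⋯ + dₙ`. -/
def Word.deg {A : GradedQuiver k} : {X Y : A.Ob} → Word A X Y → ℤ
  | _, _, .nil _ => 0
  | _, _, .cons _ d w => d + w.deg

/-- The number `n` of tensor factors. -/
def Word.length {A : GradedQuiver k} : {X Y : A.Ob} → Word A X Y → ℕ
  | _, _, .nil _ => 0
  | _, _, .cons _ _ w => w.length + 1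

/-- The module `A(X₀,X₁)^d₁ ⊗ (A(X₁,X₂)^d₂ ⊗ (⋯ ⊗ k))`. -/
def Word.tensor {A : GradedQuiver k} : {X Y : A.Ob} → Word A X Y → ModuleCat.{u} k
  | _, _, .nil _ => ModuleCat.of k k
  | _, _, .cons (Y := Y) X d w => ModuleCat.of k (A.Hom X Y d ⊗[k] w.tensor)

def Word.tensorNil {A : GradedQuiver k} (X : A.Ob) : (Word.nil X).tensor ≃ₗ[k] k :=
  LinearEquiv.refl k k

def Word.tensorCons {A : GradedQuiver k} (X : A.Ob) {Y Z : A.Ob} (d : ℤ) (w : Word A Y Z) :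
    (Word.cons X d w).tensor ≃ₗ[k] A.Hom X Y d ⊗[k] w.tensor :=
  LinearEquiv.refl k (A.Hom X Y d ⊗[k] w.tensor)

instance (A : GradedQuiver k) : DecidableEq A.Ob := Classical.decEq _
instance (A : GradedQuiver k) (X Y : A.Ob) : DecidableEq (Word A X Y) := Classical.decEq _

/-- The module `TA(X, Y)` of morphisms of the tensor cocategory `TA`. -/
abbrev T (A : GradedQuiver k) (X Y : A.Ob) : Type u := ⨁ w : Word A X Y, w.tensor

/-- The inclusion of the summand indexed by `w`. -/
abbrev T.incl {A : GradedQuiver k} {X Y : A.Ob} (w : Word A X Y) : w.tensor →ₗ[k] T A X Y :=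
  DirectSum.lof k (Word A X Y) (fun w => w.tensor) w

/-- The generator `1_X` of `T⁰A(X, X) = k`. -/
def T.one {A : GradedQuiver k} (X : A.Ob) : T A X X :=
  T.incl (Word.nil X) ((Word.tensorNil X).symm 1)

/-- The homogeneous elements of degree `d` of `TA(X, Y)`. -/
def T.deg {A : GradedQuiver k} (X Y : A.Ob) (d : ℤ) : Submodule k (T A X Y) where
  carrier := {t | ∀ w : Word A X Y, w.deg ≠ d → t w = 0}
  add_mem' := by
    intro a b ha hb w hw
    rw [DirectSum.add_apply, ha w hw, hb w hw, add_zero]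
  zero_mem' := by
    intro w _
    rfl
  smul_mem' := by
    intro c a ha w hw
    rw [DirectSum.smul_apply, ha w hw, smul_zero]

/-- The projection `pr_n : TA → TⁿA`, as an endomorphism of `TA`. -/
def T.pr {A : GradedQuiver k} (n : ℕ) {X Y : A.Ob} : T A X Y →ₗ[k] T A X Y :=
  DirectSum.toModule k (Word A X Y) (T A X Y)
    (fun w => if w.length = n then T.incl w else 0)

/-- The operator `y ↦ (-1)^(p · deg y) y`. -/
def T.sign {A : GradedQuiver k} (p : ℤ) {X Y : A.Ob} : T A X Y →ₗ[k] T A X Y :=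
  DirectSum.toModule k (Word A X Y) (T A X Y)
    (fun w => (Int.negOnePow (p * w.deg)) • T.incl w)

/-- `a ↦ (t ↦ a ⊗ t)`, putting one more factor in front. -/
def T.cons {A : GradedQuiver k} (X : A.Ob) (Y Z : A.Ob) (d : ℤ) :
    A.Hom X Y d →ₗ[k] T A Y Z →ₗ[k] T A X Z :=
  (DirectSum.toModule k (Word A Y Z) (A.Hom X Y d →ₗ[k] T A X Z)
    (fun w => ((TensorProduct.mk k (A.Hom X Y d) w.tensor).compr₂
      (T.incl (Word.cons X d w) ∘ₗ (Word.tensorCons X d w).symm.toLinearMap)).flip)).flip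

/-- Concatenation `TA(X, Z) ⊗ TA(Z, Y) → TA(X, Y)` restricted in the first factor to one word. -/
def Word.concat {A : GradedQuiver k} (Y : A.Ob) :
    {X Z : A.Ob} → (w : Word A X Z) → w.tensor →ₗ[k] T A Z Y →ₗ[k] T A X Y
  | _, _, .nil X =>
      LinearMap.toSpanSingleton k (T A X Y →ₗ[k] T A X Y) LinearMap.id ∘ₗ
        (Word.tensorNil X).toLinearMap
  | _, _, .cons (Y := Y') (Z := Z) X d w =>
      TensorProduct.lift
        (((LinearMap.llcomp k (T A Z Y) (T A Y' Y) (T A X Y)) ∘ₗ T.cons X Y' Y d).compl₂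
          (w.concat Y)) ∘ₗ (Word.tensorCons X d w).toLinearMap

/-- Concatenation `TA(X, Z) ⊗ TA(Z, Y) → TA(X, Y)`. -/
def T.concat {A : GradedQuiver k} (X Z Y : A.Ob) : T A X Z ⊗[k] T A Z Y →ₗ[k] T A X Y :=
  TensorProduct.lift
    (DirectSum.toModule k (Word A X Z) (T A Z Y →ₗ[k] T A X Y) (fun w => w.concat Y))

/-- `⨁_Z TA(X, Z) ⊗ TA(Z, Y)`. -/
abbrev TT (A : GradedQuiver k) (X Y : A.Ob) : Type u := ⨁ Z : A.Ob, T A X Z ⊗[k] T A Z Y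

abbrev TT.incl {A : GradedQuiver k} {X Y : A.Ob} (Z : A.Ob) :
    T A X Z ⊗[k] T A Z Y →ₗ[k] TT A X Y :=
  DirectSum.lof k A.Ob (fun Z => T A X Z ⊗[k] T A Z Y) Z

/-- `a ↦ (t' ⊗ t'' ↦ (a ⊗ t') ⊗ t'')`. -/
def TT.cons {A : GradedQuiver k} (X Y Z : A.Ob) (d : ℤ) :
    A.Hom X Y d →ₗ[k] TT A Y Z →ₗ[k] TT A X Z :=
  (DirectSum.toModule k A.Ob (A.Hom X Y d →ₗ[k] TT A X Z)
    (fun W => ((LinearMap.llcomp k _ _ _ (TT.incl W)) ∘ₗ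
      LinearMap.rTensorHom (T A W Z) ∘ₗ T.cons X Y W d).flip)).flip

/-- The cut comultiplication on one summand: `Δ(1_X) = 1_X ⊗ 1_X` and
`Δ(a ⊗ t) = 1_X ⊗ (a ⊗ t) + ∑ (a ⊗ t') ⊗ t''`, where `Δ(t) = ∑ t' ⊗ t''`. -/
def Word.comul {A : GradedQuiver k} : {X Y : A.Ob} → (w : Word A X Y) → w.tensor →ₗ[k] TT A X Y
  | _, _, .nil X =>
      LinearMap.toSpanSingleton k (TT A X X) (TT.incl X (T.one X ⊗ₜ[k] T.one X)) ∘ₗ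
        (Word.tensorNil X).toLinearMap
  | _, _, .cons (Y := Y) (Z := Z) X d w =>
      TT.incl X ∘ₗ TensorProduct.mk k (T A X X) (T A X Z) (T.one X) ∘ₗ T.incl (Word.cons X d w) +
      TensorProduct.lift ((TT.cons X Y Z d).compl₂ w.comul) ∘ₗ (Word.tensorCons X d w).toLinearMap

/-- The cut comultiplication `Δ : TA(X, Y) → ⨁_Z TA(X, Z) ⊗ TA(Z, Y)`,
`h₁ ⊗ ⋯ ⊗ hₙ ↦ ∑_{0 ≤ i ≤ n} (h₁ ⊗ ⋯ ⊗ hᵢ) ⊗ (hᵢ₊₁ ⊗ ⋯ ⊗ hₙ)`. -/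
def T.comul {A : GradedQuiver k} (X Y : A.Ob) : T A X Y →ₗ[k] TT A X Y :=
  DirectSum.toModule k (Word A X Y) (TT A X Y) (fun w => w.comul)

def Word.counit {A : GradedQuiver k} : {X Y : A.Ob} → (w : Word A X Y) → w.tensor →ₗ[k] k
  | _, _, .nil X => (Word.tensorNil X).toLinearMap
  | _, _, .cons _ _ _ => 0

/-- The counit: the projection to `T⁰A(X, X) = k` if `X = Y`, and zero if `X ≠ Y`. -/
def T.counit {A : GradedQuiver k} (X Y : A.Ob) : T A X Y →ₗ[k] k :=
  DirectSum.toModule k (Word A X Y) k (fun w => w.counit)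

/-- Systems of `k`-linear maps `TA(X, Y) → TB(Xf, Yg)`. -/
abbrev TMap (A B : GradedQuiver k) (f g : A.Ob → B.Ob) : Type u :=
  ∀ X Y : A.Ob, T A X Y →ₗ[k] T B (f X) (g Y)

/-- The system `r` has degree `p`. -/
def HasDegree {A B : GradedQuiver k} {f g : A.Ob → B.Ob} (p : ℤ) (r : TMap A B f g) : Prop :=
  ∀ (X Y : A.Ob) (d : ℤ) (t : T A X Y), t ∈ T.deg X Y d → r X Y t ∈ T.deg (f X) (g Y) (d + p)

/-- `φ ⊗ ψ`, for `φ` of degree `p`, with Koszul's rule for right operators: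
`(x ⊗ y)(φ ⊗ ψ) = (-1)^(deg y · p) xφ ⊗ yψ`. -/
def koszulTensor {A B : GradedQuiver k} {f g h : A.Ob → B.Ob} (p : ℤ)
    (φ : TMap A B f g) (ψ : TMap A B g h) (X Z Y : A.Ob) :
    T A X Z ⊗[k] T A Z Y →ₗ[k] T B (f X) (g Z) ⊗[k] T B (g Z) (h Y) :=
  TensorProduct.map (φ X Z) (ψ Z Y ∘ₗ T.sign p)

/-- `φ ⊗ ψ` on `⨁_Z TA(X, Z) ⊗ TA(Z, Y)`; the summand of `Z` is sent to that of `Zg`. -/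
def tensorTT {A B : GradedQuiver k} {f g h : A.Ob → B.Ob} (p : ℤ)
    (φ : TMap A B f g) (ψ : TMap A B g h) (X Y : A.Ob) : TT A X Y →ₗ[k] TT B (f X) (h Y) :=
  DirectSum.toModule k A.Ob (TT B (f X) (h Y))
    (fun Z => TT.incl (g Z) ∘ₗ koszulTensor p φ ψ X Z Y)

/-- `f : TA → TB` is a homomorphism of graded cocategories (of degree 0):
`fΔ = Δ(f ⊗ f)` and `fε = ε`. -/
structure IsCocatHom {A B : GradedQuiver k} {f : A.Ob → B.Ob} (F : TMap A B f f) : Prop where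
  degree : HasDegree 0 F
  comul : ∀ X Y : A.Ob, T.comul (f X) (f Y) ∘ₗ F X Y = tensorTT 0 F F X Y ∘ₗ T.comul X Y
  counit : ∀ X Y : A.Ob, T.counit (f X) (f Y) ∘ₗ F X Y = T.counit X Y

/-- `r : TA → TB` is an `(F, G)`-coderivation of degree `p`: `rΔ = Δ(F ⊗ r + r ⊗ G)`. -/
structure IsCoderivation {A B : GradedQuiver k} {f g : A.Ob → B.Ob}
    (F : TMap A B f f) (G : TMap A B g g) (p : ℤ) (r : TMap A B f g) : Prop where
  degree : HasDegree p r
  comul : ∀ X Y : A.Ob, T.comul (f X) (g Y) ∘ₗ r X Y =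
    (tensorTT 0 F r X Y + tensorTT p r G X Y) ∘ₗ T.comul X Y

/-- Systems of linear endomorphisms of the modules `TA(X, Y)`. -/
abbrev TEnd (A : GradedQuiver k) : Type u := TMap A A (fun X => X) (fun X => X)

/-- The identity homomorphism of `TA`. -/
def TEnd.one (A : GradedQuiver k) : TEnd A := fun _ _ => LinearMap.id

/-- An `A∞`-structure on the graded quiver `A`: a differential `b : TsA → TsA` of degree 1 which is
a `(1,1)`-coderivation and satisfies `(T⁰sA)b = 0`. -/
@[ext]
structure AInfStructure (A : GradedQuiver k) where
  b : TEnd A.susp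
  isCoderivation : IsCoderivation (TEnd.one A.susp) (TEnd.one A.susp) 1 b
  b_sq : ∀ X Y : A.susp.Ob, b X Y ∘ₗ b X Y = 0
  b_one : ∀ X : A.susp.Ob, b X X (T.one X) = 0

/-- An `A∞`-category. -/
structure AInfCat (k : Type u) [CommRing k] where
  quiver : GradedQuiver k
  str : AInfStructure quiver

/-- `TsA` for an `A∞`-category `A` is the tensor cocategory of this quiver. -/
abbrev AInfCat.s (A : AInfCat k) : GradedQuiver k := A.quiver.susp

/-- The differential `b : TsA → TsA`. -/
abbrev AInfCat.b (A : AInfCat k) : TEnd A.s := A.str.b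

/-- An `A∞`-functor: a cocategory homomorphism `TsA → TsB` of degree 0 that commutes with the
differentials and maps `T⁰sA` to `T⁰sB`. -/
structure AInfFunctor (A B : AInfCat k) where
  obj : A.s.Ob → B.s.Ob
  map : TMap A.s B.s obj obj
  isCocatHom : IsCocatHom map
  comm : ∀ X Y : A.s.Ob, B.b (obj X) (obj Y) ∘ₗ map X Y = map X Y ∘ₗ A.b X Y
  map_one : ∀ X : A.s.Ob, T.pr 0 (map X X (T.one X)) = map X X (T.one X)

section Linearity

variable {A B : GradedQuiver k} {f g h : A.Ob → B.Ob}

lemma tensorTT_add_left (p : ℤ) (φ φ' : TMap A B f g) (ψ : TMap A B g h) (X Y : A.Ob) :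
    tensorTT p (φ + φ') ψ X Y = tensorTT p φ ψ X Y + tensorTT p φ' ψ X Y := by
  refine DirectSum.linearMap_ext k fun Z => ?_
  ext x y
  simp [tensorTT, koszulTensor, TensorProduct.add_tmul]

lemma tensorTT_add_right (p : ℤ) (φ : TMap A B f g) (ψ ψ' : TMap A B g h) (X Y : A.Ob) :
    tensorTT p φ (ψ + ψ') X Y = tensorTT p φ ψ X Y + tensorTT p φ ψ' X Y := by
  refine DirectSum.linearMap_ext k fun Z => ?_
  ext x y
  simp [tensorTT, koszulTensor, TensorProduct.tmul_add]

lemma tensorTT_smul_left (p : ℤ) (c : k) (φ : TMap A B f g) (ψ : TMap A B g h) (X Y : A.Ob) :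
    tensorTT p (c • φ) ψ X Y = c • tensorTT p φ ψ X Y := by
  refine DirectSum.linearMap_ext k fun Z => ?_
  ext x y
  simp [tensorTT, koszulTensor, ← TensorProduct.smul_tmul']

lemma tensorTT_smul_right (p : ℤ) (c : k) (φ : TMap A B f g) (ψ : TMap A B g h) (X Y : A.Ob) :
    tensorTT p φ (c • ψ) X Y = c • tensorTT p φ ψ X Y := by
  refine DirectSum.linearMap_ext k fun Z => ?_
  ext x y
  simp [tensorTT, koszulTensor]

/-- The product `φ * ψ = Δ(φ ⊗ ψ)·`, where the dot is concatenation in `TB` and `φ` has degree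
`p`. -/
def conv (p : ℤ) (φ : TMap A B f g) (ψ : TMap A B g h) : TMap A B f h := fun X Y =>
  DirectSum.toModule k A.Ob (T B (f X) (h Y))
    (fun Z => T.concat (f X) (g Z) (h Y) ∘ₗ koszulTensor p φ ψ X Z Y) ∘ₗ T.comul X Y

lemma conv_add_left (p : ℤ) (φ φ' : TMap A B f g) (ψ : TMap A B g h) :
    conv p (φ + φ') ψ = conv p φ ψ + conv p φ' ψ := by
  funext X Y
  simp only [conv, Pi.add_apply, ← LinearMap.add_comp]
  congr 1
  refine DirectSum.linearMap_ext k fun Z => ?_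
  ext x y
  simp [koszulTensor, TensorProduct.add_tmul]

lemma conv_add_right (p : ℤ) (φ : TMap A B f g) (ψ ψ' : TMap A B g h) :
    conv p φ (ψ + ψ') = conv p φ ψ + conv p φ ψ' := by
  funext X Y
  simp only [conv, Pi.add_apply, ← LinearMap.add_comp]
  congr 1
  refine DirectSum.linearMap_ext k fun Z => ?_
  ext x y
  simp [koszulTensor, TensorProduct.tmul_add]

lemma conv_smul_left (p : ℤ) (c : k) (φ : TMap A B f g) (ψ : TMap A B g h) :
    conv p (c • φ) ψ = c • conv p φ ψ := by
  funext X Y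
  simp only [conv, Pi.smul_apply, ← LinearMap.smul_comp]
  congr 1
  refine DirectSum.linearMap_ext k fun Z => ?_
  ext x y
  simp [koszulTensor, ← TensorProduct.smul_tmul']

lemma conv_smul_right (p : ℤ) (c : k) (φ : TMap A B f g) (ψ : TMap A B g h) :
    conv p φ (c • ψ) = c • conv p φ ψ := by
  funext X Y
  simp only [conv, Pi.smul_apply, ← LinearMap.smul_comp]
  congr 1
  refine DirectSum.linearMap_ext k fun Z => ?_
  ext x y
  simp [koszulTensor]

end Linearity

/-- The module of `A∞`-transformations `r : f → g : A → B` of degree `p`, that is, of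
`(f, g)`-coderivations `r : TsA → TsB` of degree `p`. -/
def AInfTrans {A B : AInfCat k} (f g : AInfFunctor A B) (p : ℤ) :
    Submodule k (TMap A.s B.s f.obj g.obj) where
  carrier := {r | IsCoderivation f.map g.map p r}
  add_mem' := by
    rintro r r' ⟨hd, hc⟩ ⟨hd', hc'⟩
    refine ⟨fun X Y d t ht => Submodule.add_mem _ (hd X Y d t ht) (hd' X Y d t ht),
      fun X Y => ?_⟩
    rw [Pi.add_apply, Pi.add_apply, LinearMap.comp_add, hc, hc', tensorTT_add_left,
      tensorTT_add_right, ← LinearMap.add_comp]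
    congr 1
    abel
  zero_mem' := by
    refine ⟨fun X Y d t _ => Submodule.zero_mem _, fun X Y => ?_⟩
    have h1 := tensorTT_smul_right 0 (0 : k) f.map (0 : TMap A.s B.s f.obj g.obj) X Y
    have h2 := tensorTT_smul_left p (0 : k) (0 : TMap A.s B.s f.obj g.obj) g.map X Y
    rw [zero_smul, zero_smul] at h1 h2
    rw [h1, h2, Pi.zero_apply, Pi.zero_apply, LinearMap.comp_zero, add_zero, LinearMap.zero_comp]
  smul_mem' := by
    rintro c r ⟨hd, hc⟩
    refine ⟨fun X Y d t ht => Submodule.smul_mem _ c (hd X Y d t ht), fun X Y => ?_⟩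
    rw [Pi.smul_apply, Pi.smul_apply, LinearMap.comp_smul, hc, tensorTT_smul_left,
      tensorTT_smul_right, ← smul_add, LinearMap.smul_comp]

/-- The graded quiver `A∞(A, B)`: its objects are the `A∞`-functors `A → B`, and
`A∞(A, B)(f, g)^(d+1)` consists of the `A∞`-transformations `f → g` of degree `d`. -/
def AInfQuiver (A B : AInfCat k) : GradedQuiver k where
  Ob := AInfFunctor A B
  Hom f g d := AInfTrans f g (d - 1)

/-- The quiver `sA∞(A, B)`. -/
abbrev sAInf (A B : AInfCat k) : GradedQuiver k := (AInfQuiver A B).susp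

/-- The coderivation `TsA → TsB` underlying an element of degree `d` of `sA∞(A, B)(f, g)`. -/
def sAInf.toMap {A B : AInfCat k} (f g : (sAInf A B).Ob) (d : ℤ) :
    (sAInf A B).Hom f g d →ₗ[k] TMap A.s B.s (AInfFunctor.obj f) (AInfFunctor.obj g) :=
  (AInfTrans (A := A) (B := B) f g (d + 1 - 1)).subtype

/-- The map `r ↦ r pr₁` on systems of linear maps. -/
def TMap.prOne {A B : GradedQuiver k} {f g : A.Ob → B.Ob} (r : TMap A B f g) : TMap A B f g :=
  fun X Y => T.pr 1 ∘ₗ r X Y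

/-- `(r, ψ) ↦ f * (r pr₁) * ψ`, for `r : f → g` an `A∞`-transformation of degree `d`. -/
def thetaStep {A B : AInfCat k} (f g : (sAInf A B).Ob) (h : A.s.Ob → B.s.Ob) (d : ℤ) :
    (sAInf A B).Hom f g d →ₗ[k] TMap A.s B.s (AInfFunctor.obj g) h →ₗ[k] TMap A.s B.s (AInfFunctor.obj f) h :=
  LinearMap.mk₂ k
    (fun r ψ => conv 0 (AInfFunctor.map f) (conv d (TMap.prOne (sAInf.toMap f g d r)) ψ))
    (by
      intro r r' ψ
      rw [← conv_add_right, ← conv_add_left, map_add]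
      congr 2
      funext X Y
      simp [TMap.prOne, LinearMap.comp_add])
    (by
      intro c r ψ
      rw [← conv_smul_right, ← conv_smul_left, map_smul]
      congr 2
      funext X Y
      simp [TMap.prOne, LinearMap.comp_smul])
    (by
      intro r ψ ψ'
      rw [← conv_add_right, ← conv_add_right])
    (by
      intro c r ψ
      rw [← conv_smul_right, ← conv_smul_right])

/-- `θ` on one summand of `TsA∞(A, B)`: `()θ = f⁰` for `n = 0`, and
`(r¹ ⊗ ⋯ ⊗ rⁿ)θ = f⁰ * (r¹ pr₁) * (r² ⊗ ⋯ ⊗ rⁿ)θ`. As `f * g` has matrix elements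
`(f * g)_{kl} = ∑ f_{ij} ⊗ g_{k-i,l-j}`, this is
`θ_{kl} = ∑ f⁰_{i₀m₀} ⊗ r¹_{j₁} ⊗ f¹_{i₁m₁} ⊗ ⋯ ⊗ rⁿ_{jₙ} ⊗ fⁿ_{iₙmₙ}`, summed over
`i₀ + j₁ + i₁ + ⋯ + jₙ + iₙ = k` and `m₀ + ⋯ + mₙ + n = l`. -/
def Word.theta {A B : AInfCat k} :
    {f g : (sAInf A B).Ob} → (w : Word (sAInf A B) f g) →
      w.tensor →ₗ[k] TMap A.s B.s (AInfFunctor.obj f) (AInfFunctor.obj g)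
  | _, _, .nil f =>
      LinearMap.toSpanSingleton k _ (AInfFunctor.map f) ∘ₗ (Word.tensorNil f).toLinearMap
  | _, _, .cons (Y := g) (Z := h) f d w =>
      TensorProduct.lift ((thetaStep f g (AInfFunctor.obj h) d).compl₂ w.theta) ∘ₗ
        (Word.tensorCons f d w).toLinearMap

/-- `θ : TsA∞(A, B)(f, g) → Hom(TsA, TsB)`. -/
def theta {A B : AInfCat k} (f g : (sAInf A B).Ob) :
    T (sAInf A B) f g →ₗ[k] TMap A.s B.s (AInfFunctor.obj f) (AInfFunctor.obj g) :=
  DirectSum.toModule k (Word (sAInf A B) f g) _ (fun w => w.theta)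

/-- The equation `(r¹ ⊗ ⋯ ⊗ rⁿ)θb = [(r¹ ⊗ ⋯ ⊗ rⁿ)D]θ + (-1)^(r¹ + ⋯ + rⁿ) b(r¹ ⊗ ⋯ ⊗ rⁿ)θ`, for
all `n ≥ 0`. Operators act on the right, so `xy` is the map `y ∘ x`. -/
def ThetaCompatible {A B : AInfCat k} (D : TEnd (sAInf A B)) : Prop :=
  ∀ (f g : (sAInf A B).Ob) (w : Word (sAInf A B) f g) (r : w.tensor) (X Y : A.s.Ob),
    B.b (AInfFunctor.obj f X) (AInfFunctor.obj g Y) ∘ₗ theta f g (T.incl w r) X Y =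
      theta f g (D f g (T.incl w r)) X Y +
        Int.negOnePow w.deg • (theta f g (T.incl w r) X Y ∘ₗ A.b X Y)

/-- The symmetry `x ⊗ y ↦ (-1)^(deg x · deg y) y ⊗ x`. -/
def braiding {A C : GradedQuiver k} (X Y : A.Ob) (U V : C.Ob) :
    T A X Y ⊗[k] T C U V →ₗ[k] T C U V ⊗[k] T A X Y :=
  TensorProduct.lift
    (DirectSum.toModule k (Word A X Y) (T C U V →ₗ[k] T C U V ⊗[k] T A X Y)
      (fun w => (TensorProduct.mk k (T C U V) (T A X Y)).flip.compl₁₂ (T.incl w)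
        (T.sign w.deg)))

/-- `1 ⊗ c ⊗ 1`, with `c` the symmetry. -/
def middleSwap {A C : GradedQuiver k} (X Z Y : A.Ob) (U W V : C.Ob) :
    (T A X Z ⊗[k] T A Z Y) ⊗[k] (T C U W ⊗[k] T C W V) →ₗ[k]
      (T A X Z ⊗[k] T C U W) ⊗[k] (T A Z Y ⊗[k] T C W V) :=
  (TensorProduct.assoc k (T A X Z) (T C U W) (T A Z Y ⊗[k] T C W V)).symm.toLinearMap ∘ₗ
    LinearMap.lTensor (T A X Z)
      ((TensorProduct.assoc k (T C U W) (T A Z Y) (T C W V)).toLinearMap ∘ₗ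
        LinearMap.rTensor (T C W V) (braiding Z Y U W) ∘ₗ
        (TensorProduct.assoc k (T A Z Y) (T C U W) (T C W V)).symm.toLinearMap) ∘ₗ
    (TensorProduct.assoc k (T A X Z) (T A Z Y) (T C U W ⊗[k] T C W V)).toLinearMap

/-- Systems of linear maps `TA(X, Y) ⊗ TC(U, V) → TB((X, U)φ, (Y, V)φ)`. -/
abbrev TBiMap (A C B : GradedQuiver k) (obj : A.Ob → C.Ob → B.Ob) : Type u :=
  ∀ (X Y : A.Ob) (U V : C.Ob), T A X Y ⊗[k] T C U V →ₗ[k] T B (obj X U) (obj Y V)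

/-- `(Δ ⊗ Δ)(1 ⊗ c ⊗ 1)(φ ⊗ φ)` for `φ` of degree 0. Here `(Δ ⊗ Δ)(1 ⊗ c ⊗ 1)` is the
comultiplication of the cocategory `TA ⊗ TC`, whose objects are pairs of objects. -/
def TBiMap.comulTensor {A C B : GradedQuiver k} {obj : A.Ob → C.Ob → B.Ob}
    (φ : TBiMap A C B obj) (X Y : A.Ob) (U V : C.Ob) :
    T A X Y ⊗[k] T C U V →ₗ[k] TT B (obj X U) (obj Y V) :=
  DirectSum.toModule k (A.Ob × C.Ob) (TT B (obj X U) (obj Y V))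
      (fun Q => TT.incl (obj Q.1 Q.2) ∘ₗ
        TensorProduct.map (φ X Q.1 U Q.2) (φ Q.1 Y Q.2 V) ∘ₗ
        middleSwap X Q.1 Y U Q.2 V) ∘ₗ
    (TensorProduct.directSum k k (fun Z : A.Ob => T A X Z ⊗[k] T A Z Y)
      (fun W : C.Ob => T C U W ⊗[k] T C W V)).toLinearMap ∘ₗ
    TensorProduct.map (T.comul X Y) (T.comul U V)

/-- `φ : TA ⊗ TC → TB` is a homomorphism of graded cocategories (of degree 0). -/
structure IsCocatBiHom {A C B : GradedQuiver k} {obj : A.Ob → C.Ob → B.Ob}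
    (φ : TBiMap A C B obj) : Prop where
  degree : ∀ (X Y : A.Ob) (U V : C.Ob) (d e : ℤ) (a : T A X Y) (c : T C U V),
    a ∈ T.deg X Y d → c ∈ T.deg U V e →
      φ X Y U V (a ⊗ₜ[k] c) ∈ T.deg (obj X U) (obj Y V) (d + e)
  comul : ∀ (X Y : A.Ob) (U V : C.Ob),
    T.comul (obj X U) (obj Y V) ∘ₗ φ X Y U V = φ.comulTensor X Y U V
  counit : ∀ (X Y : A.Ob) (U V : C.Ob) (a : T A X Y) (c : T C U V),
    T.counit (obj X U) (obj Y V) (φ X Y U V (a ⊗ₜ[k] c)) = T.counit X Y a * T.counit U V c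

/-- `1 ⊗ b + b ⊗ 1` on `TA ⊗ TC`, for differentials of degree 1:
`a ⊗ c ↦ a ⊗ cb + (-1)^(deg c) ab ⊗ c`. -/
def tensorDifferential {A C : GradedQuiver k} (bA : TEnd A) (bC : TEnd C)
    (X Y : A.Ob) (U V : C.Ob) : T A X Y ⊗[k] T C U V →ₗ[k] T A X Y ⊗[k] T C U V :=
  TensorProduct.map LinearMap.id (bC U V) + TensorProduct.map (bA X Y) (T.sign 1)

/-- An `A∞`-functor `φ : TsA ⊗ TsC → TsB` of two arguments: a cocategory homomorphism of degree 0
that commutes with the differentials and maps `T⁰sA ⊗ T⁰sC` to `T⁰sB`. -/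
structure IsAInfBiFunctor {A C B : AInfCat k} {obj : A.s.Ob → C.s.Ob → B.s.Ob}
    (φ : TBiMap A.s C.s B.s obj) : Prop where
  isCocatBiHom : IsCocatBiHom φ
  comm : ∀ (X Y : A.s.Ob) (U V : C.s.Ob),
    B.b (obj X U) (obj Y V) ∘ₗ φ X Y U V =
      φ X Y U V ∘ₗ tensorDifferential A.b C.b X Y U V
  map_one : ∀ (X : A.s.Ob) (U : C.s.Ob),
    T.pr 0 (φ X X U U (T.one X ⊗ₜ[k] T.one U)) = φ X X U U (T.one X ⊗ₜ[k] T.one U)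

/-- The action `α : TsA ⊗ TsA∞(A, B) → TsB`, `a ⊗ r ↦ a[(r)θ]`, sending the object `(X, f)`
to `Xf`. -/
def action (A B : AInfCat k) :
    TBiMap A.s (sAInf A B) B.s (fun X f => AInfFunctor.obj f X) :=
  fun X Y f g => TensorProduct.lift
    (LinearMap.proj Y ∘ₗ LinearMap.proj X ∘ₗ theta f g).flip

/-- The `A∞`-category with underlying quiver `A∞(A, B)` and the given `A∞`-structure. -/
abbrev AInfCat.ofStructure {A B : AInfCat k} (S : AInfStructure (AInfQuiver A B)) : AInfCat k :=
  ⟨AInfQuiver A B, S⟩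

/-- `D` is a `(1,1)`-coderivation of degree 1 on `TsA∞(A, B)` with `D₀ = 0`, where
`D₀ = (D pr₁)|_{T⁰}`, which is compatible with `θ`. -/
structure IsThetaDifferential {A B : AInfCat k} (D : TEnd (sAInf A B)) : Prop where
  isCoderivation : IsCoderivation (TEnd.one (sAInf A B)) (TEnd.one (sAInf A B)) 1 D
  zero : ∀ f : (sAInf A B).Ob, T.pr 1 (D f f (T.one f)) = 0
  compatible : ThetaCompatible D

end AInfty

end

/-!
The theorem rests on two facts about the tensor cocategory `TB`. First, `TB` is cofree: a system of
maps `e` with `eΔ = Δ(F ⊗ e + e ⊗ G)` is zero as soon as `e pr₁ = 0` (`eq_zero_of_pr_one`), since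
counitality gives `e pr₀ = 0` and cutting off the first tensor factor expresses `e pr_{n+1}` through
`e pr₁` and `e pr_n`. Conversely every `ρ : TA → T¹B` extends to the `(F, G)`-coderivation
`F * ρ * G` (`isCoderivation_conv_conv`). Second, `θ` is comultiplicative: `(x)θΔ` is the sum of the
`Δ[(x')θ ⊗ (x'')θ]` over the cuts `x' ⊗ x''` of `x` (`IsAction.comul`). This is an induction on the
number of factors of `x` based on the formula for the comultiplication of `F * ρ * ψ`
(`comul_conv_conv`).

The differential `B` is the coderivation whose component on `x = r¹ ⊗ ⋯ ⊗ rⁿ` is the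
`A∞`-transformation `f⁰ * [(x)θb - (-1)^(deg x) b(x)θ]pr₁ * fⁿ`. The defect
`(x)θb - (xB)θ - (-1)^(deg x) b(x)θ` then has zero component `pr₁`, because `(y)θ pr₁` only depends
on `y pr₀` and `y pr₁`. The defect is a coderivation along `α`, in the sense of
`IsAction.comul_defect`, so the argument for cofreeness applies to it and shows that it vanishes
(`IsAction.defect_eq_zero`).

Uniqueness of `B` and `B² = 0` follow alike. In both cases the difference in question is a
homogeneous `y` with `yθ = 0` and `y pr₀ = 0`. Then `y pr₁ = 0`, because an `A∞`-transformation is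
determined by its component `pr₁` (`pr_one_eq_zero_of_theta`), and cofreeness of `TsA∞(A, B)`
concludes. Finally, the conditions for `α` to be a cocategory homomorphism commuting with the
differentials are the comultiplicativity of `θ` and its compatibility with `B`.
-/

open scoped TensorProduct DirectSum

noncomputable section

namespace AInfty

universe u v

variable {k : Type u} [CommRing k]

/-! ### Induction on the tensor cocategory -/

section Basic

/-- The sign `(-1)^p`, as an element of `k`. -/
def sgn (k : Type u) [CommRing k] (p : ℤ) : k := ((Int.negOnePow p : ℤˣ) : ℤ)

@[simp] lemma sgn_zero : sgn k 0 = 1 := by simp [sgn]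

lemma sgn_one : sgn k 1 = -1 := by simp [sgn]

lemma sgn_add (p q : ℤ) : sgn k (p + q) = sgn k p * sgn k q := by
  simp [sgn, Int.negOnePow_add]

lemma sgn_mul_self (p : ℤ) : sgn k p * sgn k p = 1 := by
  rw [← sgn_add, sgn, Int.negOnePow_even _ ⟨p, rfl⟩]
  simp

lemma negOnePow_smul {M : Type*} [AddCommGroup M] [Module k M] (p : ℤ) (x : M) :
    Int.negOnePow p • x = sgn k p • x := by
  rw [Units.smul_def, sgn, Int.cast_smul_eq_zsmul]

variable {A : GradedQuiver k}

lemma T.cons_incl (X : A.Ob) {Y Z : A.Ob} (d : ℤ) (a : A.Hom X Y d) (w : Word A Y Z)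
    (t : w.tensor) : T.cons X Y Z d a (T.incl w t) =
      T.incl (Word.cons X d w) ((Word.tensorCons X d w).symm (a ⊗ₜ[k] t)) := by
  simp [T.cons]

lemma T.incl_mem_deg {X Y : A.Ob} (w : Word A X Y) (t : w.tensor) :
    T.incl w t ∈ T.deg X Y w.deg := by
  intro w' hw'
  have : w ≠ w' := fun h => hw' (by rw [h])
  exact DirectSum.of_eq_of_ne _ _ _ this.symm

/-- A homogeneous element is a sum of elements of summands of its degree. -/
lemma T.incl_induction {X Y : A.Ob} {d : ℤ} {motive : T A X Y → Prop} (zero : motive 0)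
    (add : ∀ s t, motive s → motive t → motive (s + t))
    (incl : ∀ (w : Word A X Y) (t : w.tensor), w.deg = d → motive (T.incl w t))
    {t : T A X Y} (ht : t ∈ T.deg X Y d) : motive t := by
  classical
  rw [← DirectSum.sum_support_of t]
  refine Finset.sum_induction _ motive (fun s t => add s t) zero ?_
  intro w hw
  by_cases h : w.deg = d
  · exact incl w (t w) h
  · exact absurd (ht w h) (by simpa using hw)

/-- Every homogeneous element of `TA(X, Y)` is a sum of iterated `T.cons` applied to multiples of
the generators `1_Z`. -/
theorem T.deg_induction {motive : ∀ (X Y : A.Ob) (_ : ℤ), T A X Y → Prop}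
    (zero : ∀ X Y d, motive X Y d 0)
    (add : ∀ X Y d s t, motive X Y d s → motive X Y d t → motive X Y d (s + t))
    (smul_one : ∀ X (c : k), motive X X 0 (c • T.one X))
    (cons : ∀ X Y Z d e (a : A.Hom X Y d) (t : T A Y Z), t ∈ T.deg Y Z e → motive Y Z e t →
      motive X Z (d + e) (T.cons X Y Z d a t))
    {X Y : A.Ob} {d : ℤ} {t : T A X Y} (ht : t ∈ T.deg X Y d) : motive X Y d t := by
  have key : ∀ {X Y : A.Ob} (w : Word A X Y) (t : w.tensor), motive X Y w.deg (T.incl w t) := by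
    intro X Y w
    induction w with
    | nil X =>
      intro t
      have : T.incl (Word.nil X) t = (Word.tensorNil X t) • T.one X := by
        rw [T.one, ← map_smul, ← map_smul, smul_eq_mul, mul_one, LinearEquiv.symm_apply_apply]
      rw [this]
      exact smul_one X _
    | cons X d w ih =>
      intro t
      obtain ⟨t, rfl⟩ := (Word.tensorCons X d w).symm.surjective t
      induction t using TensorProduct.induction_on with
      | zero => rw [map_zero, map_zero]; exact zero _ _ _
      | tmul a t => rw [← T.cons_incl]; exact cons _ _ _ _ _ _ _ (T.incl_mem_deg w t) (ih t)
      | add s t hs ht => rw [map_add, map_add]; exact add _ _ _ _ _ hs ht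
  refine T.incl_induction (zero _ _ _) (add _ _ _) ?_ ht
  rintro w t rfl
  exact key w t

/-- Every element of `TA(X, Y)` is a sum of iterated `T.cons` applied to multiples of the
generators `1_Z`. -/
theorem T.induction {motive : ∀ (X Y : A.Ob), T A X Y → Prop}
    (zero : ∀ X Y, motive X Y 0)
    (add : ∀ X Y s t, motive X Y s → motive X Y t → motive X Y (s + t))
    (smul_one : ∀ X (c : k), motive X X (c • T.one X))
    (cons : ∀ X Y Z d (a : A.Hom X Y d) (t : T A Y Z), motive Y Z t →
      motive X Z (T.cons X Y Z d a t))
    {X Y : A.Ob} (t : T A X Y) : motive X Y t := by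
  induction t using DirectSum.induction_on with
  | zero => exact zero _ _
  | add s t hs ht => exact add _ _ _ _ hs ht
  | of w t =>
    exact T.deg_induction (motive := fun X Y _ t => motive X Y t) (fun X Y _ => zero X Y)
      (fun X Y _ => add X Y) smul_one (fun X Y Z d _ a t _ => cons X Y Z d a t)
      (T.incl_mem_deg w t)

lemma T.one_mem_deg (X : A.Ob) : T.one X ∈ T.deg X X 0 := T.incl_mem_deg (Word.nil X) _

lemma T.cons_mem_deg (X Y Z : A.Ob) {d e : ℤ} (a : A.Hom X Y d) {t : T A Y Z}
    (ht : t ∈ T.deg Y Z e) : T.cons X Y Z d a t ∈ T.deg X Z (d + e) := by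
  refine T.incl_induction (motive := fun t => T.cons X Y Z d a t ∈ T.deg X Z (d + e)) ?_ ?_ ?_ ht
  · rw [map_zero]; exact zero_mem _
  · intro s t hs ht; rw [map_add]; exact add_mem hs ht
  · rintro w t rfl
    erw [T.cons_incl]
    exact T.incl_mem_deg (Word.cons X d w) _

@[simp] lemma T.pr_zero_one (X : A.Ob) : T.pr 0 (T.one X) = T.one X := by
  simp [T.pr, T.one, Word.length]

@[simp] lemma T.pr_succ_one (n : ℕ) (X : A.Ob) : T.pr (n + 1) (T.one X) = 0 := by
  simp [T.pr, T.one, Word.length]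

@[simp] lemma T.pr_zero_cons (X Y Z : A.Ob) (d : ℤ) (a : A.Hom X Y d) (t : T A Y Z) :
    T.pr 0 (T.cons X Y Z d a t) = 0 := by
  induction t using DirectSum.induction_on with
  | zero => simp
  | add s t hs ht => rw [map_add, map_add, hs, ht, add_zero]
  | of w t =>
    erw [T.cons_incl]
    simp [T.pr, Word.length]

@[simp] lemma T.pr_succ_cons (n : ℕ) (X Y Z : A.Ob) (d : ℤ) (a : A.Hom X Y d) (t : T A Y Z) :
    T.pr (n + 1) (T.cons X Y Z d a t) = T.cons X Y Z d a (T.pr n t) := by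
  induction t using DirectSum.induction_on with
  | zero => simp
  | add s t hs ht => simp only [map_add, hs, ht]
  | of w t =>
    erw [T.cons_incl]
    simp only [T.pr, Word.length, DirectSum.toModule_lof]
    erw [DirectSum.toModule_lof]
    by_cases h : w.length = n
    · simp [h, T.cons_incl]
    · simp [h]

@[simp] lemma T.sign_incl (p : ℤ) {X Y : A.Ob} (w : Word A X Y) (t : w.tensor) :
    T.sign p (T.incl w t) = sgn k (p * w.deg) • T.incl w t := by
  rw [← negOnePow_smul (k := k) (M := T A X Y)]
  simp [T.sign]

@[simp] lemma T.sign_one (p : ℤ) (X : A.Ob) : T.sign p (T.one X) = T.one X := by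
  simp [T.one, T.sign, Word.deg]

@[simp] lemma T.sign_cons (p : ℤ) (X Y Z : A.Ob) (d : ℤ) (a : A.Hom X Y d) (t : T A Y Z) :
    T.sign p (T.cons X Y Z d a t) = sgn k (p * d) • T.cons X Y Z d a (T.sign p t) := by
  induction t using DirectSum.induction_on with
  | zero => simp
  | add s t hs ht => simp only [map_add, hs, ht, smul_add]
  | of w t =>
    erw [T.cons_incl, T.sign_incl, T.sign_incl]
    rw [map_smul, smul_smul, Word.deg, mul_add, sgn_add]
    erw [T.cons_incl]

@[simp] lemma T.counit_one (X : A.Ob) : T.counit X X (T.one X) = 1 := by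
  simp [T.counit, T.one, Word.counit]

@[simp] lemma T.counit_cons (X Y Z : A.Ob) (d : ℤ) (a : A.Hom X Y d) (t : T A Y Z) :
    T.counit X Z (T.cons X Y Z d a t) = 0 := by
  induction t using DirectSum.induction_on with
  | zero => simp
  | add s t hs ht => simp only [map_add, hs, ht, add_zero]
  | of w t =>
    erw [T.cons_incl]
    simp [T.counit, Word.counit]

/-- Concatenation, as a bilinear map. -/
def T.mul (X Z Y : A.Ob) : T A X Z →ₗ[k] T A Z Y →ₗ[k] T A X Y :=
  DirectSum.toModule k (Word A X Z) (T A Z Y →ₗ[k] T A X Y) (fun w => w.concat Y)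

lemma T.concat_tmul (X Z Y : A.Ob) (s : T A X Z) (t : T A Z Y) :
    T.concat X Z Y (s ⊗ₜ[k] t) = T.mul X Z Y s t := rfl

@[simp] lemma T.mul_one_left (X Y : A.Ob) (t : T A X Y) : T.mul X X Y (T.one X) t = t := by
  simp [T.mul, T.one, Word.concat]

@[simp] lemma T.mul_cons (X Y Z W : A.Ob) (d : ℤ) (a : A.Hom X Y d) (s : T A Y Z) (t : T A Z W) :
    T.mul X Z W (T.cons X Y Z d a s) t = T.cons X Y W d a (T.mul Y Z W s t) := by
  induction s using DirectSum.induction_on with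
  | zero => simp
  | add s t hs ht => simp only [map_add, hs, ht, LinearMap.add_apply]
  | of w s =>
    erw [T.cons_incl]
    simp only [T.mul, DirectSum.toModule_lof, Word.concat]
    erw [DirectSum.toModule_lof]
    simp

lemma T.comul_one (X : A.Ob) : T.comul X X (T.one X) = TT.incl X (T.one X ⊗ₜ[k] T.one X) := by
  simp [T.comul, T.one, Word.comul]

lemma T.comul_cons (X Y Z : A.Ob) (d : ℤ) (a : A.Hom X Y d) (t : T A Y Z) :
    T.comul X Z (T.cons X Y Z d a t) =
      TT.incl X (T.one X ⊗ₜ[k] T.cons X Y Z d a t) + TT.cons X Y Z d a (T.comul Y Z t) := by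
  induction t using DirectSum.induction_on with
  | zero => simp
  | add s t hs ht => simp only [map_add, hs, ht, TensorProduct.tmul_add]; abel
  | of w s =>
    erw [T.cons_incl]
    simp only [T.comul, DirectSum.toModule_lof, Word.comul]
    erw [DirectSum.toModule_lof]
    simp

lemma TT.cons_incl (X Y Z W : A.Ob) (d : ℤ) (a : A.Hom X Y d) (s : T A Y W) (t : T A W Z) :
    TT.cons X Y Z d a (TT.incl W (s ⊗ₜ[k] t)) = TT.incl W (T.cons X Y W d a s ⊗ₜ[k] t) := by
  simp [TT.cons]

end Basic

/-! ### Sums over the cuts of an element -/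

section Cut

variable {A : GradedQuiver k} {P : Type v} [AddCommMonoid P] [Module k P]

/-- For a family of bilinear maps `β_Z : TA(X, Z) × TA(Z, Y) → P`, the linear map
`t ↦ ∑ β(t', t'')`, where `Δ(t) = ∑ t' ⊗ t''`. -/
def T.cut {X Y : A.Ob} (β : ∀ Z, T A X Z →ₗ[k] T A Z Y →ₗ[k] P) : T A X Y →ₗ[k] P :=
  DirectSum.toModule k A.Ob P (fun Z => TensorProduct.lift (β Z)) ∘ₗ T.comul X Y

lemma T.cut_one {X : A.Ob} (β : ∀ Z, T A X Z →ₗ[k] T A Z X →ₗ[k] P) :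
    T.cut β (T.one X) = β X (T.one X) (T.one X) := by
  simp [T.cut, T.comul_one]

lemma T.cut_cons {X Y Z : A.Ob} (β : ∀ W, T A X W →ₗ[k] T A W Z →ₗ[k] P) (d : ℤ)
    (a : A.Hom X Y d) (t : T A Y Z) :
    T.cut β (T.cons X Y Z d a t) = β X (T.one X) (T.cons X Y Z d a t) +
      T.cut (fun W => β W ∘ₗ T.cons X Y W d a) t := by
  have h : DirectSum.toModule k A.Ob P (fun Z => TensorProduct.lift (β Z)) ∘ₗ TT.cons X Y Z d a =
      DirectSum.toModule k A.Ob P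
        (fun W => TensorProduct.lift (β W ∘ₗ T.cons X Y W d a)) := by
    refine DirectSum.linearMap_ext k fun W => ?_
    refine TensorProduct.ext' fun x y => ?_
    simp only [LinearMap.comp_apply]
    erw [TT.cons_incl]
    simp
  simp only [T.cut, LinearMap.comp_apply, T.comul_cons, map_add]
  congr 1
  · simp
  · exact LinearMap.congr_fun h _

lemma T.comul_eq_cut (X Y : A.Ob) : T.comul X Y =
    T.cut (fun Z => (TensorProduct.mk k (T A X Z) (T A Z Y)).compr₂ (TT.incl Z)) := by
  have : DirectSum.toModule k A.Ob (TT A X Y) (fun Z => TensorProduct.lift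
      ((TensorProduct.mk k (T A X Z) (T A Z Y)).compr₂ (TT.incl Z))) = LinearMap.id := by
    refine DirectSum.linearMap_ext k fun W => ?_
    refine TensorProduct.ext' fun x y => ?_
    simp
  rw [T.cut, this, LinearMap.id_comp]

lemma T.cut_add {X Y : A.Ob} (β γ : ∀ Z, T A X Z →ₗ[k] T A Z Y →ₗ[k] P) :
    T.cut (fun Z => β Z + γ Z) = T.cut β + T.cut γ := by
  rw [T.cut, T.cut, T.cut, ← LinearMap.add_comp]
  congr 1
  refine DirectSum.linearMap_ext k fun W => ?_
  refine TensorProduct.ext' fun x y => ?_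
  simp

lemma T.cut_smul {X Y : A.Ob} (c : k) (β : ∀ Z, T A X Z →ₗ[k] T A Z Y →ₗ[k] P) :
    T.cut (fun Z => c • β Z) = c • T.cut β := by
  rw [T.cut, T.cut, ← LinearMap.smul_comp]
  congr 1
  refine DirectSum.linearMap_ext k fun W => ?_
  refine TensorProduct.ext' fun x y => ?_
  simp

lemma T.cut_zero {X Y : A.Ob} :
    T.cut (fun Z => (0 : T A X Z →ₗ[k] T A Z Y →ₗ[k] P)) = 0 := by
  have := T.cut_smul (0 : k) (fun Z => (0 : T A X Z →ₗ[k] T A Z Y →ₗ[k] P))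
  simpa using this

/-- `T.cut` as a linear map in the family of bilinear maps. -/
def T.cutₗ (A : GradedQuiver k) (P : Type v) [AddCommMonoid P] [Module k P] (X Y : A.Ob) :
    (∀ Z, T A X Z →ₗ[k] T A Z Y →ₗ[k] P) →ₗ[k] T A X Y →ₗ[k] P where
  toFun β := T.cut β
  map_add' β γ := T.cut_add β γ
  map_smul' c β := T.cut_smul c β

lemma T.cutₗ_apply {X Y : A.Ob} (β : ∀ Z, T A X Z →ₗ[k] T A Z Y →ₗ[k] P) :
    T.cutₗ A P X Y β = T.cut β := rfl

lemma T.map_cut {Q : Type*} [AddCommMonoid Q] [Module k Q] (F : P →ₗ[k] Q) {X Y : A.Ob}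
    (β : ∀ Z, T A X Z →ₗ[k] T A Z Y →ₗ[k] P) :
    F ∘ₗ T.cut β = T.cut (fun Z => (β Z).compr₂ F) := by
  rw [T.cut, T.cut, ← LinearMap.comp_assoc]
  congr 1
  refine DirectSum.linearMap_ext k fun W => ?_
  refine TensorProduct.ext' fun x y => ?_
  simp

lemma T.map_cut_apply {Q : Type*} [AddCommMonoid Q] [Module k Q] (F : P →ₗ[k] Q) {X Y : A.Ob}
    (β : ∀ Z, T A X Z →ₗ[k] T A Z Y →ₗ[k] P) (t : T A X Y) :
    F (T.cut β t) = T.cut (fun Z => (β Z).compr₂ F) t :=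
  LinearMap.congr_fun (T.map_cut F β) t

/-- Coassociativity of the cut comultiplication. -/
theorem T.cut_assoc {X Y : A.Ob}
    (τ : ∀ Z W, T A X Z →ₗ[k] T A Z W →ₗ[k] T A W Y →ₗ[k] P) :
    T.cut (fun W => T.cut (fun Z => τ Z W)) =
      T.cut (fun Z => T.cutₗ A P Z Y ∘ₗ LinearMap.pi (fun W => τ Z W)) := by
  refine LinearMap.ext fun t => ?_
  refine T.induction (motive := fun X Y t => ∀ τ : ∀ Z W, T A X Z →ₗ[k] T A Z W →ₗ[k]
    T A W Y →ₗ[k] P, T.cut (fun W => T.cut (fun Z => τ Z W)) t =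
      T.cut (fun Z => T.cutₗ A P Z Y ∘ₗ LinearMap.pi (fun W => τ Z W)) t) ?_ ?_ ?_ ?_ t τ
  · intros; rw [map_zero, map_zero]
  · intro _ _ s t hs ht τ; rw [map_add, map_add, hs, ht]
  · intro X c τ
    rw [map_smul, map_smul, T.cut_one, T.cut_one, T.cut_one]
    simp only [LinearMap.comp_apply, T.cutₗ_apply]
    erw [T.cut_one]
    rfl
  · intro X Y Z d a t ih τ
    rw [T.cut_cons, T.cut_cons, T.cut_one]
    have h1 : (fun W => T.cut (fun Z => τ Z W) ∘ₗ T.cons X Y W d a) =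
        fun W => (τ X W (T.one X)) ∘ₗ T.cons X Y W d a +
          T.cut (fun Z => τ Z W ∘ₗ T.cons X Y Z d a) := by
      funext W
      refine LinearMap.ext fun s => ?_
      rw [LinearMap.comp_apply, T.cut_cons]
      rfl
    rw [h1, T.cut_add, LinearMap.add_apply, ih, ← add_assoc]
    congr 1
    simp only [LinearMap.comp_apply, T.cutₗ_apply]
    erw [T.cut_cons]
    rfl

lemma T.cut_sign (p : ℤ) {X Y : A.Ob} (β : ∀ Z, T A X Z →ₗ[k] T A Z Y →ₗ[k] P) (t : T A X Y) :
    T.cut β (T.sign p t) = T.cut (fun Z => (β Z).compl₁₂ (T.sign p) (T.sign p)) t := by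
  refine T.induction (motive := fun X Y t => ∀ β : ∀ Z, T A X Z →ₗ[k] T A Z Y →ₗ[k] P,
    T.cut β (T.sign p t) = T.cut (fun Z => (β Z).compl₁₂ (T.sign p) (T.sign p)) t) ?_ ?_ ?_ ?_ t β
  · intros; simp
  · intro _ _ s t hs ht τ; simp only [map_add, hs, ht]
  · intro X c β
    simp [T.cut_one]
  · intro X Y Z d a t ih β
    rw [T.sign_cons, map_smul, T.cut_cons, T.cut_cons, smul_add, ih]
    congr 1
    · rw [LinearMap.compl₁₂_apply, T.sign_one, T.sign_cons, map_smul]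
    · have h : (fun Z => (β Z).compl₁₂ (T.sign p) (T.sign p) ∘ₗ T.cons X Y Z d a) =
        fun Z => sgn k (p * d) •
          (β Z ∘ₗ T.cons X Y Z d a).compl₁₂ (T.sign p) (T.sign p) := by
        funext W
        refine LinearMap.ext₂ fun x y => ?_
        simp
      rw [h, T.cut_smul]
      rfl

/-- A bilinear family taking values in a submodule on pairs of homogeneous elements of total
degree `d` takes the elements of degree `d` there. -/
lemma T.cut_mem {X Y : A.Ob} {d : ℤ} {t : T A X Y} (ht : t ∈ T.deg X Y d) (S : Submodule k P)
    (β : ∀ Z, T A X Z →ₗ[k] T A Z Y →ₗ[k] P)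
    (hβ : ∀ Z d₁ d₂ x y, x ∈ T.deg X Z d₁ → y ∈ T.deg Z Y d₂ → d₁ + d₂ = d → β Z x y ∈ S) :
    T.cut β t ∈ S := by
  refine T.deg_induction (motive := fun X Y d t => ∀ β : ∀ Z, T A X Z →ₗ[k] T A Z Y →ₗ[k] P,
    (∀ Z d₁ d₂ x y, x ∈ T.deg X Z d₁ → y ∈ T.deg Z Y d₂ → d₁ + d₂ = d → β Z x y ∈ S) →
    T.cut β t ∈ S) ?_ ?_ ?_ ?_ ht β hβ
  · intros; rw [map_zero]; exact zero_mem _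
  · intro _ _ _ s t hs ht τ h; rw [map_add]; exact add_mem (hs τ h) (ht τ h)
  · intro X c β h
    rw [map_smul, T.cut_one]
    exact S.smul_mem _ (h X 0 0 _ _ (T.one_mem_deg X) (T.one_mem_deg X) rfl)
  · intro X Y Z d e a t ht ih β h
    rw [T.cut_cons]
    refine add_mem (h X 0 _ _ _ (T.one_mem_deg X) (T.cons_mem_deg _ _ _ a ht) (zero_add _))
      (ih _ ?_)
    intro W d₁ d₂ x y hx hy hd
    exact h W (d + d₁) d₂ _ _ (T.cons_mem_deg _ _ _ a hx) hy (by omega)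

end Cut

/-! ### Convolution products and concatenation -/

section Convolve

variable {A : GradedQuiver k}

lemma T.sign_sign (p q : ℤ) {X Y : A.Ob} (t : T A X Y) :
    T.sign p (T.sign q t) = T.sign (p + q) t := by
  refine T.induction (motive := fun X Y t => T.sign p (T.sign q t) = T.sign (p + q) t)
    ?_ ?_ ?_ ?_ t
  · intros; simp
  · intro _ _ s t hs ht; simp only [map_add, hs, ht]
  · intros; simp
  · intro X Y Z d a t ih
    rw [T.sign_cons, map_smul, T.sign_cons, T.sign_cons, ih, smul_smul, add_mul, sgn_add, mul_comm]

@[simp] lemma T.sign_zero {X Y : A.Ob} : T.sign (A := A) 0 = (LinearMap.id : T A X Y →ₗ[k] _) := by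
  refine LinearMap.ext fun t => ?_
  refine T.induction (motive := fun X Y t => T.sign 0 t = LinearMap.id t) ?_ ?_ ?_ ?_ t
  · intros; simp
  · intro _ _ s t hs ht; simp only [map_add, hs, ht]
  · intros; simp
  · intro X Y Z d a t ih
    rw [T.sign_cons, ih]; simp

variable {P : Type v} [AddCommMonoid P] [Module k P]

/-- The product `t ↦ ∑ ± μ(φ(t'), ψ(t''))` of two families of linear maps out of `TA`, with respect
to bilinear maps `μ_Z`, where `Δ(t) = ∑ t' ⊗ t''` and the sign `(-1)^(p · deg t'')` is that of
Koszul's rule for `φ` of degree `p`. -/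
def T.convolve {M N : A.Ob → Type*} [∀ Z, AddCommMonoid (M Z)] [∀ Z, Module k (M Z)]
    [∀ Z, AddCommMonoid (N Z)] [∀ Z, Module k (N Z)] (μ : ∀ Z, M Z →ₗ[k] N Z →ₗ[k] P) {X Y : A.Ob}
    (p : ℤ) (φ : ∀ Z, T A X Z →ₗ[k] M Z) (ψ : ∀ Z, T A Z Y →ₗ[k] N Z) : T A X Y →ₗ[k] P :=
  T.cut (fun Z => (μ Z).compl₁₂ (φ Z) (ψ Z ∘ₗ T.sign p))

/-- Associativity of convolution: if `μ₁(μ₂(m, n), r) = μ₃(m, μ₄(n, r))`, then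
`(φ * ψ) * χ = φ * (ψ * χ)` for the corresponding products, signs included. -/
theorem T.convolve_assoc {M R MN NR : A.Ob → Type*} {N : A.Ob → A.Ob → Type*}
    [∀ Z, AddCommMonoid (M Z)] [∀ Z, Module k (M Z)]
    [∀ Z W, AddCommMonoid (N Z W)] [∀ Z W, Module k (N Z W)]
    [∀ Z, AddCommMonoid (R Z)] [∀ Z, Module k (R Z)]
    [∀ Z, AddCommMonoid (MN Z)] [∀ Z, Module k (MN Z)]
    [∀ Z, AddCommMonoid (NR Z)] [∀ Z, Module k (NR Z)]
    (μ₁ : ∀ W, MN W →ₗ[k] R W →ₗ[k] P) (μ₂ : ∀ Z W, M Z →ₗ[k] N Z W →ₗ[k] MN W)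
    (μ₃ : ∀ Z, M Z →ₗ[k] NR Z →ₗ[k] P) (μ₄ : ∀ Z W, N Z W →ₗ[k] R W →ₗ[k] NR Z)
    (h : ∀ Z W m n r, μ₁ W (μ₂ Z W m n) r = μ₃ Z m (μ₄ Z W n r)) {X Y : A.Ob} (p q : ℤ)
    (φ : ∀ Z, T A X Z →ₗ[k] M Z) (ψ : ∀ Z W, T A Z W →ₗ[k] N Z W) (χ : ∀ W, T A W Y →ₗ[k] R W) :
    T.convolve μ₁ (p + q) (fun W => T.convolve (fun Z => μ₂ Z W) p φ (fun Z => ψ Z W)) χ =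
      T.convolve μ₃ p φ (fun Z => T.convolve (fun W => μ₄ Z W) q (ψ Z) χ) := by
  set τ : ∀ Z W, T A X Z →ₗ[k] T A Z W →ₗ[k] T A W Y →ₗ[k] P := fun Z W =>
    ((μ₂ Z W).compl₁₂ (φ Z) (ψ Z W ∘ₗ T.sign p)).compr₂ ((μ₁ W).compl₂ (χ W ∘ₗ T.sign (p + q)))
    with hτ
  have h1 : T.convolve μ₁ (p + q) (fun W => T.convolve (fun Z => μ₂ Z W) p φ (fun Z => ψ Z W)) χ =
      T.cut (fun W => T.cut (fun Z => τ Z W)) := by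
    rw [T.convolve]
    congr 1
    funext W
    rw [hτ, ← T.map_cut]
    rfl
  rw [h1, T.cut_assoc, T.convolve]
  congr 1
  funext Z
  refine LinearMap.ext₂ fun x y => ?_
  rw [LinearMap.comp_apply, T.cutₗ_apply, LinearMap.compl₁₂_apply, LinearMap.comp_apply,
    T.convolve, T.cut_sign, T.map_cut_apply]
  congr 2
  funext W
  refine LinearMap.ext₂ fun y z => ?_
  simp [hτ, h, T.sign_sign, add_comm p q]

variable {B : GradedQuiver k}

lemma T.comp_convolve {Q : Type*} [AddCommMonoid Q] [Module k Q] {M N : A.Ob → Type*}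
    [∀ Z, AddCommMonoid (M Z)] [∀ Z, Module k (M Z)] [∀ Z, AddCommMonoid (N Z)]
    [∀ Z, Module k (N Z)] (F : P →ₗ[k] Q) (μ : ∀ Z, M Z →ₗ[k] N Z →ₗ[k] P) {X Y : A.Ob}
    (p : ℤ) (φ : ∀ Z, T A X Z →ₗ[k] M Z) (ψ : ∀ Z, T A Z Y →ₗ[k] N Z) :
    F ∘ₗ T.convolve μ p φ ψ = T.convolve (fun Z => (μ Z).compr₂ F) p φ ψ :=
  T.map_cut F _

@[simp] lemma T.mul_one_right (X Y : A.Ob) (t : T A X Y) : T.mul X Y Y t (T.one Y) = t := by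
  refine T.induction (motive := fun X Y t => T.mul X Y Y t (T.one Y) = t) ?_ ?_ ?_ ?_ t
  · intros; simp
  · intro _ _ s t hs ht; simp only [map_add, LinearMap.add_apply, hs, ht]
  · intros; simp
  · intro X Y Z d a t ih
    rw [T.mul_cons, ih]

lemma T.mul_mem_deg {X Y Z : A.Ob} {d e : ℤ} {s : T A X Y} {t : T A Y Z} (hs : s ∈ T.deg X Y d)
    (ht : t ∈ T.deg Y Z e) : T.mul X Y Z s t ∈ T.deg X Z (d + e) := by
  refine T.deg_induction (motive := fun X Y d s => ∀ t : T A Y Z, t ∈ T.deg Y Z e →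
    T.mul X Y Z s t ∈ T.deg X Z (d + e)) ?_ ?_ ?_ ?_ hs t ht
  · intros; simp
  · intro _ _ _ s t hs ht r hr
    simp only [map_add, LinearMap.add_apply]
    exact add_mem (hs r hr) (ht r hr)
  · intro X c t ht
    simpa using Submodule.smul_mem _ c ht
  · intro X Y Z d e a s _ ih t ht
    rw [T.mul_cons, add_assoc]
    exact T.cons_mem_deg _ _ _ a (ih t ht)

lemma T.sign_eq_of_mem (p : ℤ) {X Y : A.Ob} {d : ℤ} {t : T A X Y} (ht : t ∈ T.deg X Y d) :
    T.sign p t = sgn k (p * d) • t := by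
  refine T.deg_induction (motive := fun X Y d t => T.sign p t = sgn k (p * d) • t) ?_ ?_ ?_ ?_ ht
  · intros; simp
  · intro _ _ _ s t hs ht; simp only [map_add, hs, ht, smul_add]
  · intros; simp
  · intro X Y Z d e a t _ ih
    rw [T.sign_cons, ih, map_smul, smul_smul, mul_add, sgn_add]

lemma T.sign_mem_deg (p : ℤ) {X Y : A.Ob} {d : ℤ} {t : T A X Y} (ht : t ∈ T.deg X Y d) :
    T.sign p t ∈ T.deg X Y d := by
  rw [T.sign_eq_of_mem p ht]
  exact Submodule.smul_mem _ _ ht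

/-- `s ↦ (t' ⊗ t'' ↦ st' ⊗ t'')`. -/
def TT.mulLeft (X Z Y : A.Ob) : T A X Z →ₗ[k] TT A Z Y →ₗ[k] TT A X Y :=
  (DirectSum.toModule k A.Ob (T A X Z →ₗ[k] TT A X Y)
    (fun W => ((LinearMap.llcomp k _ _ _ (TT.incl W)) ∘ₗ
      LinearMap.rTensorHom (T A W Y) ∘ₗ T.mul X Z W).flip)).flip

/-- `s' ⊗ s'' ↦ (t ↦ s' ⊗ s''t)`. -/
def TT.mulRight (X Z Y : A.Ob) : TT A X Z →ₗ[k] T A Z Y →ₗ[k] TT A X Y :=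
  DirectSum.toModule k A.Ob (T A Z Y →ₗ[k] TT A X Y)
    (fun W => ((LinearMap.llcomp k _ _ _ (TT.incl W)) ∘ₗ
      LinearMap.lTensorHom (T A X W) ∘ₗ (T.mul W Z Y).flip).flip)

@[simp] lemma TT.mulLeft_incl (X Z Y W : A.Ob) (s : T A X Z) (t : T A Z W) (t' : T A W Y) :
    TT.mulLeft X Z Y s (TT.incl W (t ⊗ₜ[k] t')) = TT.incl W (T.mul X Z W s t ⊗ₜ[k] t') := by
  simp [TT.mulLeft]

@[simp] lemma TT.mulRight_incl (X Z Y W : A.Ob) (s : T A X W) (s' : T A W Z) (t : T A Z Y) :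
    TT.mulRight X Z Y (TT.incl W (s ⊗ₜ[k] s')) t = TT.incl W (s ⊗ₜ[k] T.mul W Z Y s' t) := by
  simp [TT.mulRight]

/-- Linear maps out of `⨁_Z TA(X, Z) ⊗ TA(Z, Y)` are determined by their values on the elements
`s ⊗ t`. -/
lemma TT.hom_ext {X Y : A.Ob} {F G : TT A X Y →ₗ[k] P}
    (h : ∀ Z (s : T A X Z) (t : T A Z Y), F (TT.incl Z (s ⊗ₜ[k] t)) = G (TT.incl Z (s ⊗ₜ[k] t))) :
    F = G := by
  refine DirectSum.linearMap_ext k fun W => ?_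
  exact TensorProduct.ext' fun x y => h W x y

lemma TT.mulLeft_one (X Y : A.Ob) : TT.mulLeft X X Y (T.one X) = LinearMap.id :=
  TT.hom_ext fun Z s t => by simp

lemma TT.mulLeft_cons (X Y Z W : A.Ob) (d : ℤ) (a : A.Hom X Y d) (s : T A Y Z) :
    TT.mulLeft X Z W (T.cons X Y Z d a s) = TT.cons X Y W d a ∘ₗ TT.mulLeft Y Z W s :=
  TT.hom_ext fun Z s t => by
    rw [LinearMap.comp_apply, TT.mulLeft_incl, TT.mulLeft_incl, TT.cons_incl, T.mul_cons]

lemma TT.mulRight_cons (X Y Z W : A.Ob) (d : ℤ) (a : A.Hom X Y d) (x : TT A Y Z) (t : T A Z W) :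
    TT.mulRight X Z W (TT.cons X Y Z d a x) t = TT.cons X Y W d a (TT.mulRight Y Z W x t) := by
  have : (TT.mulRight X Z W).flip t ∘ₗ TT.cons X Y Z d a =
      TT.cons X Y W d a ∘ₗ (TT.mulRight Y Z W).flip t :=
    TT.hom_ext fun Z s t => by
      simp only [LinearMap.comp_apply, LinearMap.flip_apply]
      rw [TT.cons_incl, TT.mulRight_incl, TT.mulRight_incl, TT.cons_incl]
  exact LinearMap.congr_fun this x

/-- The elements of `T¹A` are sums of elements `a ⊗ 1`. -/
lemma T.pr_one_induction {X Y : A.Ob} {motive : T A X Y → Prop} (zero : motive 0)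
    (add : ∀ s t, motive s → motive t → motive (s + t))
    (cons : ∀ d (a : A.Hom X Y d), motive (T.cons X Y Y d a (T.one Y))) (t : T A X Y) :
    motive (T.pr 1 t) := by
  refine T.induction (motive := fun X Y t => ∀ motive : T A X Y → Prop, motive 0 →
    (∀ s t, motive s → motive t → motive (s + t)) →
    (∀ d (a : A.Hom X Y d), motive (T.cons X Y Y d a (T.one Y))) → motive (T.pr 1 t))
    ?_ ?_ ?_ ?_ t motive zero add cons
  · intro _ _ motive zero _ _; rwa [map_zero]
  · intro _ _ s t hs ht motive zero add cons
    rw [map_add]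
    exact add _ _ (hs _ zero add cons) (ht _ zero add cons)
  · intro X c motive zero _ _
    rw [map_smul, T.pr_succ_one 0, smul_zero]
    exact zero
  · intro X Y Z d a t _
    refine T.induction (motive := fun Y Z t => ∀ (a : A.Hom X Y d) (motive : T A X Z → Prop),
      motive 0 → (∀ s t, motive s → motive t → motive (s + t)) →
      (∀ d (a : A.Hom X Z d), motive (T.cons X Z Z d a (T.one Z))) →
      motive (T.pr 1 (T.cons X Y Z d a t))) ?_ ?_ ?_ ?_ t a
    · intro _ _ a motive zero _ _; simpa using zero
    · intro _ _ s t hs ht a motive zero add cons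
      rw [map_add, map_add]
      exact add _ _ (hs _ _ zero add cons) (ht _ _ zero add cons)
    · intro Y c a motive zero _ cons
      rw [T.pr_succ_cons 0, map_smul, T.pr_zero_one, map_smul, ← LinearMap.smul_apply, ← map_smul]
      exact cons _ _
    · intro Y Y' Z e a' t _ a motive zero _ _
      rw [T.pr_succ_cons 0, T.pr_zero_cons, map_zero]
      exact zero

/-- The comultiplication of a product `s · ρ · t` with `ρ ∈ T¹A`: the cut is made either in `s` or
in `t`. -/
lemma T.comul_mul_mul {X Z W Y : A.Ob} (s : T A X Z) {ρ : T A Z W} (hρ : T.pr 1 ρ = ρ)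
    (t : T A W Y) : T.comul X Y (T.mul X Z Y s (T.mul Z W Y ρ t)) =
      TT.mulRight X Z Y (T.comul X Z s) (T.mul Z W Y ρ t) +
        TT.mulLeft X Z Y s (TT.mulLeft Z W Y ρ (T.comul W Y t)) := by
  rw [← hρ]
  refine T.pr_one_induction (motive := fun ρ => T.comul X Y (T.mul X Z Y s (T.mul Z W Y ρ t)) =
      TT.mulRight X Z Y (T.comul X Z s) (T.mul Z W Y ρ t) +
        TT.mulLeft X Z Y s (TT.mulLeft Z W Y ρ (T.comul W Y t))) ?_ ?_ ?_ ρ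
  · simp
  · intro r r' h h'
    simp only [map_add, LinearMap.add_apply, h, h']
    abel
  · intro d a
    rw [T.mul_cons, T.mul_one_left, TT.mulLeft_cons, TT.mulLeft_one, LinearMap.comp_id]
    refine T.induction (motive := fun X Z s => ∀ a : A.Hom Z W d,
      T.comul X Y (T.mul X Z Y s (T.cons Z W Y d a t)) =
      TT.mulRight X Z Y (T.comul X Z s) (T.cons Z W Y d a t) +
        TT.mulLeft X Z Y s (TT.cons Z W Y d a (T.comul W Y t))) ?_ ?_ ?_ ?_ s a
    · intros; simp
    · intro _ _ s s' h h' a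
      simp only [map_add, LinearMap.add_apply, h, h']
      abel
    · intro X c a
      simp only [map_smul, LinearMap.smul_apply]
      rw [T.mul_one_left, T.comul_cons, T.comul_one, TT.mulRight_incl, T.mul_one_left,
        TT.mulLeft_one, LinearMap.id_apply, smul_add]
    · intro X X' Z e a' s ih a
      rw [T.mul_cons, T.comul_cons, ih, T.comul_cons, map_add (TT.mulRight X Z Y),
        LinearMap.add_apply, TT.mulRight_incl, T.mul_cons, TT.mulRight_cons, TT.mulLeft_cons,
        LinearMap.comp_apply, map_add, add_assoc]

end Convolve

/-! ### Counitality and the projections `pr_n` -/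

section Counit

variable {A : GradedQuiver k} {P : Type v} [AddCommMonoid P] [Module k P]

/-- Left counitality, for a family `β` which in its first argument factors through `T⁰A`. -/
lemma T.cut_eq_left {X Y : A.Ob} (β : ∀ Z, T A X Z →ₗ[k] T A Z Y →ₗ[k] P)
    (h : ∀ W Z d (a : A.Hom X W d) (x : T A W Z), β Z (T.cons X W Z d a x) = 0) (t : T A X Y) :
    T.cut β t = β X (T.one X) t := by
  refine T.induction (motive := fun X Y t => ∀ β : ∀ Z, T A X Z →ₗ[k] T A Z Y →ₗ[k] P,
    (∀ W Z d (a : A.Hom X W d) (x : T A W Z), β Z (T.cons X W Z d a x) = 0) →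
      T.cut β t = β X (T.one X) t) ?_ ?_ ?_ ?_ t β h
  · intros; simp
  · intro _ _ s t hs ht β h; rw [map_add, map_add, hs β h, ht β h]
  · intro X c β _
    rw [map_smul, map_smul, T.cut_one]
  · intro X Y Z d a t _ β h
    have : (fun W => β W ∘ₗ T.cons X Y W d a) = fun W => 0 := by
      funext W
      exact LinearMap.ext fun x => h _ _ _ _ _
    rw [T.cut_cons, this, T.cut_zero, LinearMap.zero_apply, add_zero]

/-- Right counitality, for a family `β` which in its second argument factors through `T⁰A`. -/
lemma T.cut_eq_right {X Y : A.Ob} (β : ∀ Z, T A X Z →ₗ[k] T A Z Y →ₗ[k] P)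
    (h : ∀ W Z d (a : A.Hom Z W d) (y : T A W Y) (x : T A X Z), β Z x (T.cons Z W Y d a y) = 0)
    (t : T A X Y) : T.cut β t = β Y t (T.one Y) := by
  refine T.induction (motive := fun X Y t => ∀ β : ∀ Z, T A X Z →ₗ[k] T A Z Y →ₗ[k] P,
    (∀ W Z d (a : A.Hom Z W d) (y : T A W Y) (x : T A X Z), β Z x (T.cons Z W Y d a y) = 0) →
      T.cut β t = β Y t (T.one Y)) ?_ ?_ ?_ ?_ t β h
  · intros; simp
  · intro _ _ s t hs ht β h; rw [map_add, map_add, hs β h, ht β h, LinearMap.add_apply]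
  · intro X c β _
    rw [map_smul, map_smul, T.cut_one, LinearMap.smul_apply]
  · intro X Y Z d a t ih β h
    rw [T.cut_cons, ih _ fun W Z d a y x => h W Z d a y _, h, zero_add]
    rfl

lemma T.pr_pr_of_ne {m n : ℕ} (h : m ≠ n) {X Y : A.Ob} (t : T A X Y) :
    T.pr m (T.pr n t) = 0 := by
  induction t using DirectSum.induction_on with
  | zero => simp
  | add s t hs ht => simp only [map_add, hs, ht, add_zero]
  | of w t =>
    change T.pr m (T.pr n (T.incl w t)) = 0
    simp only [T.pr, DirectSum.toModule_lof]
    by_cases hw : w.length = n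
    · simp [hw, Ne.symm h]
    · simp [hw]

lemma T.pr_pr_self (n : ℕ) {X Y : A.Ob} (t : T A X Y) : T.pr n (T.pr n t) = T.pr n t := by
  induction t using DirectSum.induction_on with
  | zero => simp
  | add s t hs ht => simp only [map_add, hs, ht]
  | of w t =>
    change T.pr n (T.pr n (T.incl w t)) = T.pr n (T.incl w t)
    simp only [T.pr, DirectSum.toModule_lof]
    by_cases hw : w.length = n
    · simp [hw]
    · simp [hw]

lemma T.eq_zero_of_pr {X Y : A.Ob} (t : T A X Y) (h : ∀ n, T.pr n t = 0) : t = 0 := by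
  have key : ∀ (n : ℕ) (w : Word A X Y), w.length = n → (T.pr n t) w = t w := by
    intro n w hw
    clear h
    induction t using DirectSum.induction_on with
    | zero => simp
    | add s t hs ht => rw [map_add, DirectSum.add_apply, DirectSum.add_apply, hs, ht]
    | of w' t =>
      change (T.pr n (T.incl w' t)) w = (T.incl w' t) w
      simp only [T.pr, DirectSum.toModule_lof]
      by_cases h : w' = w
      · subst h
        simp [hw]
      · have h0 : (T.incl w' t) w = 0 := DirectSum.of_eq_of_ne _ _ _ (Ne.symm h)
        rw [h0]
        by_cases hw' : w'.length = n
        · simp only [hw', if_true]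
          exact h0
        · simp [hw']
  refine DFinsupp.ext fun w => ?_
  rw [← key _ w rfl, h]

lemma T.pr_mem_deg (n : ℕ) {X Y : A.Ob} {d : ℤ} {t : T A X Y} (ht : t ∈ T.deg X Y d) :
    T.pr n t ∈ T.deg X Y d := by
  refine T.deg_induction (motive := fun X Y d t => ∀ n, T.pr n t ∈ T.deg X Y d) ?_ ?_ ?_ ?_ ht n
  · intros; simp
  · intro _ _ _ s t hs ht n; rw [map_add]; exact add_mem (hs n) (ht n)
  · intro X c n
    rw [map_smul]
    cases n with
    | zero => rw [T.pr_zero_one]; exact Submodule.smul_mem _ c (T.one_mem_deg X)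
    | succ n => rw [T.pr_succ_one, smul_zero]; exact zero_mem _
  · intro X Y Z d e a t _ ih n
    cases n with
    | zero => rw [T.pr_zero_cons]; exact zero_mem _
    | succ n => rw [T.pr_succ_cons]; exact T.cons_mem_deg _ _ _ a (ih n)

lemma T.pr_zero_eq {X : A.Ob} (t : T A X X) : T.pr 0 t = T.counit X X t • T.one X := by
  refine T.induction (motive := fun X Y t => ∀ h : X = Y,
    T.pr 0 t = T.counit X Y t • (h ▸ T.one X : T A X Y)) ?_ ?_ ?_ ?_ t rfl
  · rintro X _ rfl; simp
  · rintro X _ s t hs ht rfl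
    simpa only [map_add, add_smul] using congrArg₂ (· + ·) (hs rfl) (ht rfl)
  · intro X c _; simp
  · rintro X Y _ d a t _ rfl; simp

lemma T.pr_zero_of_counit {X Y : A.Ob} {t : T A X Y} (ht : T.counit X Y t = 0) :
    T.pr 0 t = 0 := by
  by_cases h : X = Y
  · subst h
    rw [T.pr_zero_eq, ht, zero_smul]
  · refine T.induction (motive := fun X Y t => X ≠ Y → T.pr 0 t = 0) ?_ ?_ ?_ ?_ t h
    · intros; simp
    · intro X _ s t hs ht h; rw [map_add, hs h, ht h, add_zero]
    · intro X c h; exact absurd rfl h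
    · intros; simp

lemma T.counit_pr_zero {X Y : A.Ob} (t : T A X Y) :
    T.counit X Y (T.pr 0 t) = T.counit X Y t := by
  refine T.induction (motive := fun X Y t => T.counit X Y (T.pr 0 t) = T.counit X Y t)
    ?_ ?_ ?_ ?_ t
  · intros; simp
  · intro X _ s t hs ht; simp only [map_add, hs, ht]
  · intros; simp
  · intros; simp

lemma T.pr_zero_mul {X Y Z : A.Ob} (s : T A X Y) (t : T A Y Z) :
    T.pr 0 (T.mul X Y Z s t) = T.mul X Y Z (T.pr 0 s) (T.pr 0 t) := by
  refine T.induction (motive := fun X Y s => ∀ t : T A Y Z,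
    T.pr 0 (T.mul X Y Z s t) = T.mul X Y Z (T.pr 0 s) (T.pr 0 t)) ?_ ?_ ?_ ?_ s t
  · intros; simp
  · intro X _ s t hs ht r; simp only [map_add, LinearMap.add_apply, hs, ht]
  · intros; simp
  · intros; simp

lemma T.pr_one_mul {X Y Z : A.Ob} (s : T A X Y) (t : T A Y Z) : T.pr 1 (T.mul X Y Z s t) =
    T.mul X Y Z (T.pr 0 s) (T.pr 1 t) + T.mul X Y Z (T.pr 1 s) (T.pr 0 t) := by
  refine T.induction (motive := fun X Y s => ∀ t : T A Y Z, T.pr 1 (T.mul X Y Z s t) =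
    T.mul X Y Z (T.pr 0 s) (T.pr 1 t) + T.mul X Y Z (T.pr 1 s) (T.pr 0 t)) ?_ ?_ ?_ ?_ s t
  · intros; simp
  · intro X _ s t hs ht r
    simp only [map_add, LinearMap.add_apply, hs, ht]
    abel
  · intro X c t
    simp [T.pr_succ_one 0]
  · intro X Y Z' d a s _ t
    rw [T.mul_cons, T.pr_succ_cons 0, T.pr_zero_cons, T.pr_succ_cons 0, T.mul_cons, T.pr_zero_mul]
    simp

/-- `pr_{n+1}` is recovered from `pr₁` and `pr_n` by cutting off the first factor. -/
lemma T.pr_succ_eq_cut (n : ℕ) {X Y : A.Ob} (t : T A X Y) : T.pr (n + 1) t =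
    T.cut (fun Z => (T.mul X Z Y).compl₁₂ (T.pr 1) (T.pr n)) t := by
  refine T.induction (motive := fun X Y t => T.pr (n + 1) t =
    T.cut (fun Z => (T.mul X Z Y).compl₁₂ (T.pr 1) (T.pr n)) t) ?_ ?_ ?_ ?_ t
  · intros; simp
  · intro X _ s t hs ht; simp only [map_add, hs, ht]
  · intro X c
    simp [T.cut_one, T.pr_succ_one 0]
  · intro X Y Z d a t _
    have h1 : (fun W => (T.mul X W Z).compl₁₂ (T.pr 1) (T.pr n) ∘ₗ T.cons X Y W d a) =
        fun W => ((T.mul Y W Z).compl₁₂ (T.pr 0) (T.pr n)).compr₂ (T.cons X Y Z d a) := by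
      funext W
      refine LinearMap.ext₂ fun x y => ?_
      simp [T.pr_succ_cons 0]
    rw [T.cut_cons, h1, ← T.map_cut, LinearMap.comp_apply, T.cut_eq_left]
    · simp [T.pr_succ_one 0]
    · intro W Z d a x
      exact LinearMap.ext fun y => by simp

lemma T.counit_eq_cut {X Y : A.Ob} (t : T A X Y) : T.counit X Y t =
    T.cut (fun Z => (LinearMap.mul k k).compl₁₂ (T.counit X Z) (T.counit Z Y)) t := by
  rw [T.cut_eq_left]
  · simp
  · intro W Z d a x
    exact LinearMap.ext fun y => by simp

end Counit

/-! ### Cocategory homomorphisms and coderivations -/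

section Coderivations

variable {A B : GradedQuiver k} {f g h l : A.Ob → B.Ob}

/-- The bilinear map `(s, t) ↦ s ⊗ t` to the summand of `Z`. -/
def TT.mk (X Z Y : A.Ob) : T A X Z →ₗ[k] T A Z Y →ₗ[k] TT A X Y :=
  (TensorProduct.mk k (T A X Z) (T A Z Y)).compr₂ (TT.incl Z)

@[simp] lemma TT.mk_apply (X Z Y : A.Ob) (s : T A X Z) (t : T A Z Y) :
    TT.mk X Z Y s t = TT.incl Z (s ⊗ₜ[k] t) := rfl

lemma conv_eq_convolve (p : ℤ) (φ : TMap A B f g) (ψ : TMap A B g h) (X Y : A.Ob) :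
    conv p φ ψ X Y =
      T.convolve (fun Z => T.mul (f X) (g Z) (h Y)) p (φ X) (fun Z => ψ Z Y) := by
  rw [conv, T.convolve, T.cut]
  congr 1
  refine TT.hom_ext fun Z s t => ?_
  simp [koszulTensor, T.concat_tmul]

lemma tensorTT_comp_comul (p : ℤ) (φ : TMap A B f g) (ψ : TMap A B g h) (X Y : A.Ob) :
    tensorTT p φ ψ X Y ∘ₗ T.comul X Y =
      T.convolve (fun Z => TT.mk (f X) (g Z) (h Y)) p (φ X) (fun Z => ψ Z Y) := by
  rw [tensorTT, T.convolve, T.cut]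
  congr 1
  refine TT.hom_ext fun Z s t => ?_
  simp [koszulTensor]

lemma comp_tensorTT_comp_comul {P : Type v} [AddCommMonoid P] [Module k P] (p : ℤ)
    (φ : TMap A B f g) (ψ : TMap A B g h) (X Y : A.Ob)
    (β : ∀ Z, T B (f X) Z →ₗ[k] T B Z (h Y) →ₗ[k] P) (t : T A X Y) :
    DirectSum.toModule k B.Ob P (fun Z => TensorProduct.lift (β Z))
      (tensorTT p φ ψ X Y (T.comul X Y t)) =
      T.convolve (fun Z => β (g Z)) p (φ X) (fun Z => ψ Z Y) t := by
  have := LinearMap.congr_fun (tensorTT_comp_comul p φ ψ X Y) t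
  rw [LinearMap.comp_apply] at this
  rw [this, ← LinearMap.comp_apply, T.comp_convolve]
  congr 2
  funext Z
  refine LinearMap.ext₂ fun x y => ?_
  simp

lemma hasDegree_conv {a b : ℤ} (p : ℤ) {φ : TMap A B f g} {ψ : TMap A B g h}
    (hφ : HasDegree a φ) (hψ : HasDegree b ψ) : HasDegree (a + b) (conv p φ ψ) := by
  intro X Y d t ht
  rw [conv_eq_convolve]
  refine T.cut_mem ht _ _ fun Z d₁ d₂ x y hx hy hd => ?_
  have := T.mul_mem_deg (hφ X Z d₁ x hx) (hψ Z Y d₂ _ (T.sign_mem_deg p hy))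
  rwa [show d₁ + a + (d₂ + b) = d + (a + b) by omega] at this

/-- Koszul's sign for moving a sign operator past a system of maps of degree `a`. -/
lemma HasDegree.sign_apply {a : ℤ} {φ : TMap A B f g} (hφ : HasDegree a φ) (p : ℤ) (X Y : A.Ob)
    (t : T A X Y) : T.sign p (φ X Y t) = sgn k (p * a) • φ X Y (T.sign p t) := by
  induction t using DirectSum.induction_on with
  | zero => simp
  | add s t hs ht => simp only [map_add, hs, ht, smul_add]
  | of w t =>
    change T.sign p (φ X Y (T.incl w t)) = sgn k (p * a) • φ X Y (T.sign p (T.incl w t))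
    have h := T.incl_mem_deg w t
    rw [T.sign_eq_of_mem p (hφ X Y _ _ h), T.sign_eq_of_mem p h, map_smul, smul_smul, mul_add,
      sgn_add, mul_comm]

/-- The comultiplication of `F * ρ * ψ`, where `F` is a cocategory homomorphism and `ρ` takes
values in `T¹B`. -/
lemma comul_conv_conv {F : TMap A B f f} (hF : IsCocatHom F) {p : ℤ} {ρ : TMap A B f g}
    (hρ : ∀ X Y t, T.pr 1 (ρ X Y t) = ρ X Y t) (ψ : TMap A B g h) (X Y : A.Ob) :
    T.comul (f X) (h Y) ∘ₗ conv 0 F (conv p ρ ψ) X Y =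
      tensorTT 0 F (conv 0 F (conv p ρ ψ)) X Y ∘ₗ T.comul X Y +
        T.convolve (fun Z => TT.mulLeft (f X) (f Z) (h Y)) 0 (F X) (fun Z =>
          T.convolve (fun W => TT.mulLeft (f Z) (g W) (h Y)) p (ρ Z)
            (fun W => T.comul (g W) (h Y) ∘ₗ ψ W Y)) := by
  -- A product `s · ρ · t` is cut either in `s` or in `t`.
  have h1 : T.comul (f X) (h Y) ∘ₗ conv 0 F (conv p ρ ψ) X Y =
      T.convolve (fun Z => TT.mulRight (f X) (f Z) (h Y)) 0
        (fun Z => T.comul (f X) (f Z) ∘ₗ F X Z) (fun Z => conv p ρ ψ Z Y) +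
      T.convolve (fun Z => TT.mulLeft (f X) (f Z) (h Y)) 0 (F X) (fun Z =>
          T.convolve (fun W => TT.mulLeft (f Z) (g W) (h Y)) p (ρ Z)
            (fun W => T.comul (g W) (h Y) ∘ₗ ψ W Y)) := by
    rw [conv_eq_convolve, T.comp_convolve, T.convolve, T.convolve, T.convolve, ← T.cut_add]
    congr 1
    funext Z
    refine LinearMap.ext₂ fun x y => ?_
    simp only [LinearMap.add_apply, LinearMap.compl₁₂_apply, LinearMap.compr₂_apply,
      LinearMap.comp_apply, T.sign_zero, LinearMap.id_apply]
    rw [conv_eq_convolve, T.convolve, T.convolve, ← LinearMap.comp_apply,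
      T.map_cut_apply, T.map_cut_apply, T.map_cut_apply,
      ← LinearMap.add_apply, ← T.cut_add]
    congr 2
    funext W
    refine LinearMap.ext₂ fun y z => ?_
    simp only [LinearMap.add_apply, LinearMap.compl₁₂_apply, LinearMap.compr₂_apply,
      LinearMap.comp_apply]
    exact T.comul_mul_mul _ (hρ _ _ _) _
  rw [h1]
  congr 1
  simp only [hF.comul]
  rw [tensorTT_comp_comul]
  simp only [tensorTT_comp_comul, conv_eq_convolve 0]
  exact T.convolve_assoc (fun Z => TT.mulRight (f X) (f Z) (h Y))
    (fun Z W => TT.mk (f X) (f Z) (f W)) (fun Z => TT.mk (f X) (f Z) (h Y))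
    (fun Z W => T.mul (f Z) (f W) (h Y)) (fun Z W m n r => by simp) 0 0 (F X) F _

/-- Associativity: `F * ρ` acts on `Δ(φ ⊗ ψ)` from the left through `φ`. -/
lemma convolve_mulLeft_tensorTT (F : TMap A B f f) (p q : ℤ) (ρ : TMap A B f g)
    (φ : TMap A B g h) (ψ : TMap A B h l) (X Y : A.Ob) :
    T.convolve (fun Z => TT.mulLeft (f X) (f Z) (l Y)) 0 (F X) (fun Z =>
      T.convolve (fun W => TT.mulLeft (f Z) (g W) (l Y)) p (ρ Z)
        (fun W => tensorTT q φ ψ W Y ∘ₗ T.comul W Y)) =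
      tensorTT (p + q) (conv 0 F (conv p ρ φ)) ψ X Y ∘ₗ T.comul X Y := by
  simp only [tensorTT_comp_comul]
  have h1 := fun Z : A.Ob => T.convolve_assoc (fun W => TT.mk (f Z) (h W) (l Y))
    (fun W V => T.mul (f Z) (g W) (h V)) (fun W => TT.mulLeft (f Z) (g W) (l Y))
    (fun W V => TT.mk (g W) (h V) (l Y)) (fun Z W m n r => by simp) p q (ρ Z) φ (fun W => ψ W Y)
  simp only [← h1]
  have h2 := T.convolve_assoc (fun W => TT.mk (f X) (h W) (l Y))
    (fun W V => T.mul (f X) (f W) (h V)) (fun W => TT.mulLeft (f X) (f W) (l Y))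
    (fun W V => TT.mk (f W) (h V) (l Y)) (fun Z W m n r => by simp) 0 (p + q) (F X)
    (conv p ρ φ) (fun W => ψ W Y)
  simp only [zero_add] at h2
  have h3 : conv 0 F (conv p ρ φ) X = fun W =>
    T.convolve (fun Z => T.mul (f X) (f Z) (h W)) 0 (F X) (fun Z => conv p ρ φ Z W) := by
    funext W
    exact conv_eq_convolve _ _ _ _ _
  have h4 : ∀ Z, conv p ρ φ Z = fun W =>
      T.convolve (fun V => T.mul (f Z) (g V) (h W)) p (ρ Z) (fun V => φ V W) := by
    intro Z
    funext W
    exact conv_eq_convolve _ _ _ _ _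
  rw [h3, h2]
  simp only [h4]

/-- `F * ρ * G` is an `(F, G)`-coderivation if `ρ` takes values in `T¹B`. -/
theorem isCoderivation_conv_conv {F : TMap A B f f} (hF : IsCocatHom F) {G : TMap A B g g}
    (hG : IsCocatHom G) {p : ℤ} {ρ : TMap A B f g} (hρ : ∀ X Y t, T.pr 1 (ρ X Y t) = ρ X Y t)
    (hd : HasDegree p ρ) : IsCoderivation F G p (conv 0 F (conv p ρ G)) where
  degree := by
    have := hasDegree_conv 0 hF.degree (hasDegree_conv p hd hG.degree)
    rwa [zero_add, add_zero] at this
  comul X Y := by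
    rw [comul_conv_conv hF hρ, LinearMap.add_comp]
    congr 1
    simp only [hG.comul]
    rw [convolve_mulLeft_tensorTT, add_zero]

lemma IsCocatHom.counit_apply {F : TMap A B f f} (hF : IsCocatHom F) (X Y : A.Ob) (t : T A X Y) :
    T.counit (f X) (f Y) (F X Y t) = T.counit X Y t :=
  LinearMap.congr_fun (hF.counit X Y) t

lemma IsCocatHom.pr_zero_one {F : TMap A B f f} (hF : IsCocatHom F) (X : A.Ob) :
    T.pr 0 (F X X (T.one X)) = T.one (f X) := by
  rw [T.pr_zero_eq, hF.counit_apply, T.counit_one, one_smul]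

lemma IsCocatHom.pr_zero_cons {F : TMap A B f f} (hF : IsCocatHom F) (X Y Z : A.Ob) (d : ℤ)
    (a : A.Hom X Y d) (t : T A Y Z) : T.pr 0 (F X Z (T.cons X Y Z d a t)) = 0 := by
  rw [T.pr_zero_of_counit]
  rw [hF.counit_apply, T.counit_cons]

lemma pr_zero_conv (p : ℤ) (φ : TMap A B f g) (ψ : TMap A B g h) (X Y : A.Ob)
    (hφ : (∀ Z t, T.pr 0 (φ X Z t) = 0) ∨ ∀ Z t, T.pr 0 (ψ Z Y t) = 0) (t : T A X Y) :
    T.pr 0 (conv p φ ψ X Y t) = 0 := by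
  rw [conv_eq_convolve, T.convolve, T.map_cut_apply]
  have : (fun Z => ((T.mul (f X) (g Z) (h Y)).compl₁₂ (φ X Z) (ψ Z Y ∘ₗ T.sign p)).compr₂
      (T.pr 0)) = fun Z => 0 := by
    funext Z
    refine LinearMap.ext₂ fun x y => ?_
    rcases hφ with hφ | hφ <;> simp [T.pr_zero_mul, hφ]
  rw [this, T.cut_zero, LinearMap.zero_apply]

/-- The component `pr₁` of `F * ρ * ψ`. -/
lemma pr_one_conv_conv {F : TMap A B f f} (hF : IsCocatHom F) {p : ℤ} {ρ : TMap A B f g}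
    (hρ : ∀ X Y t, T.pr 1 (ρ X Y t) = ρ X Y t) (ψ : TMap A B g h) (X Y : A.Ob) (t : T A X Y) :
    T.pr 1 (conv 0 F (conv p ρ ψ) X Y t) =
      conv p ρ (fun Z W => T.pr 0 ∘ₗ ψ Z W) X Y t := by
  have hρ0 : ∀ X Y t, T.pr 0 (ρ X Y t) = 0 := fun X Y t => by
    rw [← hρ, T.pr_pr_of_ne zero_ne_one]
  have h0 : ∀ X Y t, T.pr 0 (conv p ρ ψ X Y t) = 0 := fun X Y t =>
    pr_zero_conv p ρ ψ X Y (Or.inl (hρ0 X)) t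
  rw [conv_eq_convolve 0, T.convolve, T.map_cut_apply, T.cut_eq_left]
  · simp only [LinearMap.compr₂_apply, LinearMap.compl₁₂_apply, LinearMap.comp_apply, T.sign_zero,
      LinearMap.id_apply, T.pr_one_mul, h0, hF.pr_zero_one, T.mul_one_left, map_zero, add_zero]
    rw [conv_eq_convolve, conv_eq_convolve, T.convolve, T.convolve, T.map_cut_apply]
    congr 2
    funext Z
    refine LinearMap.ext₂ fun x y => ?_
    simp [T.pr_one_mul, hρ, hρ0]
  · intro W Z d a x
    refine LinearMap.ext fun y => ?_
    simp [T.pr_one_mul, h0, hF.pr_zero_cons]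

lemma pr_one_conv_conv_cocatHom {F : TMap A B f f} (hF : IsCocatHom F) {G : TMap A B g g}
    (hG : IsCocatHom G) {p : ℤ} {ρ : TMap A B f g} (hρ : ∀ X Y t, T.pr 1 (ρ X Y t) = ρ X Y t)
    (X Y : A.Ob) (t : T A X Y) : T.pr 1 (conv 0 F (conv p ρ G) X Y t) = ρ X Y t := by
  rw [pr_one_conv_conv hF hρ, conv_eq_convolve, T.convolve, T.cut_eq_right]
  · simp [hG.pr_zero_one]
  · intro W Z d a y x
    simp [hG.pr_zero_cons]

/-- The condition `eΔ = Δ(F ⊗ e + e ⊗ G)`, tested against a family of bilinear maps. -/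
lemma cut_apply_of_comul {P : Type v} [AddCommMonoid P] [Module k P] {F : TMap A B f f}
    {G : TMap A B g g} {p : ℤ} {e : TMap A B f g} {X Y : A.Ob}
    (he : T.comul (f X) (g Y) ∘ₗ e X Y =
      (tensorTT 0 F e X Y + tensorTT p e G X Y) ∘ₗ T.comul X Y)
    (β : ∀ Z, T B (f X) Z →ₗ[k] T B Z (g Y) →ₗ[k] P) (t : T A X Y) :
    T.cut β (e X Y t) = T.convolve (fun Z => β (f Z)) 0 (F X) (fun Z => e Z Y) t +
      T.convolve (fun Z => β (g Z)) p (e X) (fun Z => G Z Y) t := by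
  rw [← comp_tensorTT_comp_comul, ← comp_tensorTT_comp_comul, ← map_add, T.cut,
    LinearMap.comp_apply]
  congr 1
  exact LinearMap.congr_fun he t

lemma counit_apply_of_comul {F : TMap A B f f} (hF : IsCocatHom F) {G : TMap A B g g}
    (hG : IsCocatHom G) {p : ℤ} {e : TMap A B f g} {X Y : A.Ob}
    (he : T.comul (f X) (g Y) ∘ₗ e X Y =
      (tensorTT 0 F e X Y + tensorTT p e G X Y) ∘ₗ T.comul X Y) (t : T A X Y) :
    T.counit (f X) (g Y) (e X Y t) = 0 := by
  have := cut_apply_of_comul he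
    (fun Z => (LinearMap.mul k k).compl₁₂ (T.counit _ Z) (T.counit Z _)) t
  rw [← T.counit_eq_cut, T.convolve, T.convolve, T.cut_eq_left, T.cut_eq_right] at this
  · simpa [hF.counit_apply, hG.counit_apply] using this
  · intro W Z d a y x
    simp [hG.counit_apply]
  · intro W Z d a x
    refine LinearMap.ext fun y => ?_
    simp [hF.counit_apply]

/-- A system `e` with `eΔ = Δ(F ⊗ e + e ⊗ G)` and `e pr₁ = 0` vanishes: `e pr₀` is zero by
counitality, and `e pr_{n+1}` is determined by `e pr₁` and `e pr_n`. -/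
theorem eq_zero_of_pr_one {F : TMap A B f f} (hF : IsCocatHom F) {G : TMap A B g g}
    (hG : IsCocatHom G) {p : ℤ} {e : TMap A B f g}
    (he : ∀ X Y, T.comul (f X) (g Y) ∘ₗ e X Y =
      (tensorTT 0 F e X Y + tensorTT p e G X Y) ∘ₗ T.comul X Y)
    (h1 : ∀ X Y t, T.pr 1 (e X Y t) = 0) : e = 0 := by
  funext X Y
  refine LinearMap.ext fun t => T.eq_zero_of_pr _ fun n => ?_
  have hn : ∀ X Y t, T.pr n (e X Y t) = 0 := by
    induction n with
    | zero => exact fun X Y t => T.pr_zero_of_counit (counit_apply_of_comul hF hG (he X Y) t)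
    | succ n ih =>
      intro X Y t
      rw [T.pr_succ_eq_cut, cut_apply_of_comul (he X Y), T.convolve, T.convolve,
        ← LinearMap.add_apply, ← T.cut_add]
      convert LinearMap.zero_apply t
      convert T.cut_zero with Z
      refine LinearMap.ext₂ fun x y => ?_
      simp [ih, h1]
  exact hn X Y t

/-- Coderivations of a given degree are determined by their component `pr₁`. -/
lemma IsCoderivation.ext {F : TMap A B f f} (hF : IsCocatHom F) {G : TMap A B g g}
    (hG : IsCocatHom G) {p : ℤ} {r r' : TMap A B f g} (hr : IsCoderivation F G p r)
    (hr' : IsCoderivation F G p r') (h : ∀ X Y t, T.pr 1 (r X Y t) = T.pr 1 (r' X Y t)) :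
    r = r' := by
  have : r + (-1 : k) • r' = 0 := by
    refine eq_zero_of_pr_one hF hG (p := p) (fun X Y => ?_) fun X Y t => ?_
    · rw [Pi.add_apply, Pi.add_apply, Pi.smul_apply, Pi.smul_apply, LinearMap.comp_add,
        LinearMap.comp_smul, hr.comul, hr'.comul, tensorTT_add_left, tensorTT_add_right,
        tensorTT_smul_left, tensorTT_smul_right, ← LinearMap.smul_comp, ← LinearMap.add_comp,
        smul_add]
      congr 1
      abel
    · simp [h]
  funext X Y
  have h0 := congrFun (congrFun this X) Y
  refine LinearMap.ext fun t => ?_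
  have ht := LinearMap.congr_fun h0 t
  simp only [Pi.add_apply, Pi.smul_apply, LinearMap.add_apply, LinearMap.smul_apply] at ht
  rw [neg_one_smul, ← sub_eq_add_neg] at ht
  exact sub_eq_zero.1 ht

lemma isCocatHom_one (A : GradedQuiver k) : IsCocatHom (TEnd.one A) where
  degree X Y d t ht := by simpa [TEnd.one] using ht
  comul X Y := by
    have : tensorTT 0 (TEnd.one A) (TEnd.one A) X Y = LinearMap.id :=
      TT.hom_ext fun Z s t => by simp [tensorTT, koszulTensor, TEnd.one]
    rw [this]
    rfl
  counit X Y := rfl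

end Coderivations

/-! ### Actions of a tensor cocategory -/

section Box

variable {A B C : GradedQuiver k} {f g h l : A.Ob → B.Ob}

/-- `(φ, ψ) ↦ Δ(φ ⊗ ψ)`, as a bilinear map. -/
def comulTensor (p : ℤ) (f g h : A.Ob → B.Ob) : TMap A B f g →ₗ[k] TMap A B g h →ₗ[k]
    (∀ X Y, T A X Y →ₗ[k] TT B (f X) (h Y)) :=
  LinearMap.mk₂ k (fun φ ψ X Y => tensorTT p φ ψ X Y ∘ₗ T.comul X Y)
    (fun φ φ' ψ => by funext X Y; rw [tensorTT_add_left]; rfl)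
    (fun c φ ψ => by funext X Y; rw [tensorTT_smul_left]; rfl)
    (fun φ ψ ψ' => by funext X Y; rw [tensorTT_add_right, LinearMap.add_comp]; rfl)
    (fun c φ ψ => by funext X Y; rw [tensorTT_smul_right]; rfl)

lemma comulTensor_apply (p : ℤ) (φ : TMap A B f g) (ψ : TMap A B g h) (X Y : A.Ob) :
    comulTensor p f g h φ ψ X Y = tensorTT p φ ψ X Y ∘ₗ T.comul X Y := rfl

lemma T.convolve_add_right {P : Type v} [AddCommMonoid P] [Module k P] {M N : A.Ob → Type*}
    [∀ Z, AddCommMonoid (M Z)] [∀ Z, Module k (M Z)]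
    [∀ Z, AddCommMonoid (N Z)] [∀ Z, Module k (N Z)] (μ : ∀ Z, M Z →ₗ[k] N Z →ₗ[k] P) {X Y : A.Ob}
    (p : ℤ) (φ : ∀ Z, T A X Z →ₗ[k] M Z) (ψ ψ' : ∀ Z, T A Z Y →ₗ[k] N Z) :
    T.convolve μ p φ (fun Z => ψ Z + ψ' Z) = T.convolve μ p φ ψ + T.convolve μ p φ ψ' := by
  rw [T.convolve, T.convolve, T.convolve, ← T.cut_add]
  congr 1
  funext Z
  refine LinearMap.ext₂ fun x y => ?_
  simp

lemma T.convolve_smul_right {P : Type v} [AddCommMonoid P] [Module k P] {M N : A.Ob → Type*}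
    [∀ Z, AddCommMonoid (M Z)] [∀ Z, Module k (M Z)]
    [∀ Z, AddCommMonoid (N Z)] [∀ Z, Module k (N Z)] (μ : ∀ Z, M Z →ₗ[k] N Z →ₗ[k] P) {X Y : A.Ob}
    (p : ℤ) (φ : ∀ Z, T A X Z →ₗ[k] M Z) (c : k) (ψ : ∀ Z, T A Z Y →ₗ[k] N Z) :
    T.convolve μ p φ (fun Z => c • ψ Z) = c • T.convolve μ p φ ψ := by
  rw [T.convolve, T.convolve, ← T.cut_smul]
  congr 1
  funext Z
  refine LinearMap.ext₂ fun x y => ?_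
  simp

/-- The left action of `F * ρ` on systems of linear maps to `⨁_Z TB ⊗ TB`. -/
def leftAction (F : TMap A B f f) (p : ℤ) (ρ : TMap A B f g) (l : A.Ob → B.Ob) :
    (∀ X Y, T A X Y →ₗ[k] TT B (g X) (l Y)) →ₗ[k] (∀ X Y, T A X Y →ₗ[k] TT B (f X) (l Y)) where
  toFun Ψ X Y := T.convolve (fun Z => TT.mulLeft (f X) (f Z) (l Y)) 0 (F X) (fun Z =>
      T.convolve (fun W => TT.mulLeft (f Z) (g W) (l Y)) p (ρ Z) (fun W => Ψ W Y))
  map_add' Ψ Ψ' := by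
    funext X Y
    simp only [Pi.add_apply, T.convolve_add_right]
  map_smul' c Ψ := by
    funext X Y
    simp only [Pi.smul_apply, T.convolve_smul_right, RingHom.id_apply]

/-- For families `Φ`, `Ψ` of systems of linear maps `TA → TB` depending linearly on elements of
`TC`, the bilinear map `(x, y) ↦ Δ(Φ(x) ⊗ Ψ(y))`, with the sign of Koszul's rule for `Φ(x)` of
degree `deg x + q`. -/
def box (q : ℤ) {obj : C.Ob → A.Ob → B.Ob}
    (Φ Ψ : ∀ f g : C.Ob, T C f g →ₗ[k] TMap A B (obj f) (obj g)) (f h g : C.Ob) :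
    T C f h →ₗ[k] T C h g →ₗ[k] (∀ X Y, T A X Y →ₗ[k] TT B (obj f X) (obj g Y)) :=
  DirectSum.toModule k _ _ (fun w : Word C f h =>
    (comulTensor (w.deg + q) (obj f) (obj h) (obj g)).compl₁₂ (Φ f h ∘ₗ T.incl w) (Ψ h g))

variable {obj : C.Ob → A.Ob → B.Ob}

lemma box_of_mem (q : ℤ) (Φ Ψ : ∀ f g : C.Ob, T C f g →ₗ[k] TMap A B (obj f) (obj g))
    {f h g : C.Ob} {d : ℤ} {x : T C f h} (hx : x ∈ T.deg f h d) (y : T C h g) :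
    box q Φ Ψ f h g x y = comulTensor (d + q) (obj f) (obj h) (obj g) (Φ f h x) (Ψ h g y) := by
  refine T.incl_induction (motive := fun x => box q Φ Ψ f h g x y =
    comulTensor (d + q) (obj f) (obj h) (obj g) (Φ f h x) (Ψ h g y)) ?_ ?_ ?_ hx
  · simp
  · intro s t hs ht; simp only [map_add, LinearMap.add_apply, hs, ht]
  · rintro w t rfl
    simp [box]

/-- Bilinear maps out of `TA(X, Y) × P` agree if they do when the first argument is
homogeneous. -/
lemma T.hom_ext₂ {X Y : A.Ob} {P : Type*} {Q : Type*} [AddCommMonoid P] [Module k P]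
    [AddCommMonoid Q] [Module k Q] {F G : T A X Y →ₗ[k] P →ₗ[k] Q}
    (h : ∀ d x y, x ∈ T.deg X Y d → F x y = G x y) : F = G := by
  refine LinearMap.ext₂ fun x y => ?_
  induction x using DirectSum.induction_on with
  | zero => simp
  | add s t hs ht => simp only [map_add, LinearMap.add_apply, hs, ht]
  | of w t => exact h _ _ _ (T.incl_mem_deg w t)

lemma HasDegree.apply_sign {a : ℤ} {φ : TMap A B f g} (hφ : HasDegree a φ) (p : ℤ) (X Y : A.Ob)
    (t : T A X Y) : φ X Y (T.sign p t) = sgn k (p * a) • T.sign p (φ X Y t) := by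
  rw [hφ.sign_apply, smul_smul, sgn_mul_self, one_smul]

end Box

section PrOne

variable {A B : GradedQuiver k} {f g : A.Ob → B.Ob}

lemma TMap.pr_one_prOne (r : TMap A B f g) (X Y : A.Ob) (t : T A X Y) :
    T.pr 1 (TMap.prOne r X Y t) = TMap.prOne r X Y t :=
  T.pr_pr_self 1 _

lemma HasDegree.prOne {p : ℤ} {r : TMap A B f g} (hr : HasDegree p r) :
    HasDegree p (TMap.prOne r) :=
  fun X Y d t ht => T.pr_mem_deg 1 (hr X Y d t ht)

end PrOne

section Action

variable {A B C : GradedQuiver k} {obj : C.Ob → A.Ob → B.Ob}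

/-- An action of `TC` on `TA` with values in `TB`: elements `x` of `TC(f, g)` are sent to systems
`xθ` of linear maps `TA → TB`, units to cocategory homomorphisms, and
`(r ⊗ t)θ = (1)θ * ρ * (t)θ` where `ρ : TA → T¹B` depends on `r` only. -/
structure IsAction (θ : ∀ f g : C.Ob, T C f g →ₗ[k] TMap A B (obj f) (obj g)) : Prop where
  one : ∀ f, IsCocatHom (θ f f (T.one f))
  cons : ∀ (f g : C.Ob) (d : ℤ) (r : C.Hom f g d), ∃ ρ : TMap A B (obj f) (obj g),
    HasDegree d ρ ∧ (∀ X Y t, T.pr 1 (ρ X Y t) = ρ X Y t) ∧ ∀ (h : C.Ob) (t : T C g h),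
      θ f h (T.cons f g h d r t) = conv 0 (θ f f (T.one f)) (conv d ρ (θ g h t))

variable {θ : ∀ f g : C.Ob, T C f g →ₗ[k] TMap A B (obj f) (obj g)}

lemma IsAction.hasDegree (hθ : IsAction θ) {f g : C.Ob} {d : ℤ} {x : T C f g}
    (hx : x ∈ T.deg f g d) : HasDegree d (θ f g x) := by
  refine T.deg_induction (motive := fun f g d x => HasDegree d (θ f g x)) ?_ ?_ ?_ ?_ hx
  · intro f g d X Y e t _
    simp
  · intro f g d x y hx hy X Y e t ht
    rw [map_add]
    exact add_mem (hx X Y e t ht) (hy X Y e t ht)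
  · intro f c X Y e t ht
    rw [map_smul]
    exact Submodule.smul_mem _ c ((hθ.one f).degree X Y e t ht)
  · intro f g h d e r t _ ih
    obtain ⟨ρ, hρ, _, hcons⟩ := hθ.cons f g d r
    rw [hcons]
    have := hasDegree_conv 0 (hθ.one f).degree (hasDegree_conv d hρ ih)
    rwa [zero_add] at this

/-- The action has degree 0, expressed through the sign operators. -/
lemma IsAction.sign_apply (hθ : IsAction θ) (p : ℤ) (f g : C.Ob) (x : T C f g) (X Y : A.Ob)
    (t : T A X Y) : T.sign p (θ f g x X Y t) = θ f g (T.sign p x) X Y (T.sign p t) := by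
  induction x using DirectSum.induction_on with
  | zero => simp
  | add s t hs ht => simp only [map_add, Pi.add_apply, LinearMap.add_apply, hs, ht]
  | of w x =>
    have h := T.incl_mem_deg w x
    refine ((hθ.hasDegree h).sign_apply p X Y t).trans ?_
    have h' := T.sign_eq_of_mem p h
    change _ = θ f g (T.sign p (T.incl w x)) X Y (T.sign p t)
    rw [h', map_smul]
    rfl

/-- An action is comultiplicative:
`(r¹ ⊗ ⋯ ⊗ rⁿ)θΔ = ∑ᵢ Δ[(r¹ ⊗ ⋯ ⊗ rⁱ)θ ⊗ (rⁱ⁺¹ ⊗ ⋯ ⊗ rⁿ)θ]`. -/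
theorem IsAction.comul (hθ : IsAction θ) (f g : C.Ob) (x : T C f g) :
    (fun X Y => T.comul (obj f X) (obj g Y) ∘ₗ θ f g x X Y) =
      T.cut (fun h => box 0 θ θ f h g) x := by
  refine T.induction (motive := fun f g x => (fun X Y =>
    T.comul (obj f X) (obj g Y) ∘ₗ θ f g x X Y) = T.cut (fun h => box 0 θ θ f h g) x) ?_ ?_ ?_ ?_ x
  · intro f g
    rw [map_zero, map_zero]
    funext X Y
    simp
  · intro f g s t hs ht
    rw [map_add, map_add, ← hs, ← ht]
    funext X Y
    simp [LinearMap.comp_add]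
  · intro f c
    rw [map_smul, map_smul, T.cut_one, box_of_mem _ _ _ (T.one_mem_deg f)]
    funext X Y
    rw [Pi.smul_apply, Pi.smul_apply, LinearMap.comp_smul, (hθ.one f).comul]
    rfl
  · intro f g h d r t ih
    obtain ⟨ρ, _, hρ, hcons⟩ := hθ.cons f g d r
    rw [T.cut_cons, box_of_mem _ _ _ (T.one_mem_deg f)]
    -- The cuts of `r ⊗ t` after `r` arise from the cuts of `t` by the left action of `(1)θ * ρ`.
    have h1 : (fun l => box 0 θ θ f l h ∘ₗ T.cons f g l d r) =
        fun l => (box 0 θ θ g l h).compr₂ (leftAction (θ f f (T.one f)) d ρ (obj h)) := by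
      funext l
      refine T.hom_ext₂ fun e x y hx => ?_
      rw [LinearMap.comp_apply, LinearMap.compr₂_apply,
        box_of_mem _ _ _ (T.cons_mem_deg _ _ _ r hx), box_of_mem _ _ _ hx]
      funext X Y
      rw [comulTensor_apply, hcons, add_assoc]
      exact (convolve_mulLeft_tensorTT _ d (e + 0) _ _ _ X Y).symm
    rw [h1, ← T.map_cut, LinearMap.comp_apply, ← ih]
    funext X Y
    rw [hcons, comul_conv_conv (hθ.one f) hρ]
    rfl

/-- An action is counital. -/
lemma IsAction.counit (hθ : IsAction θ) (f g : C.Ob) (x : T C f g) (X Y : A.Ob)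
    (t : T A X Y) : T.counit (obj f X) (obj g Y) (θ f g x X Y t) =
      T.counit X Y t * T.counit f g x := by
  refine T.induction (motive := fun f g x => T.counit (obj f X) (obj g Y)
    (θ f g x X Y t) = T.counit X Y t * T.counit f g x) ?_ ?_ ?_ ?_ x
  · intro f g; simp
  · intro f g s t hs ht
    simp only [map_add, Pi.add_apply, LinearMap.add_apply, hs, ht, mul_add]
  · intro f c
    simp [(hθ.one f).counit_apply, mul_comm]
  · intro f g h d r x _
    obtain ⟨ρ, _, hρ, hcons⟩ := hθ.cons f g d r
    rw [hcons, T.counit_cons, mul_zero, ← T.counit_pr_zero, pr_zero_conv, map_zero]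
    refine Or.inr fun Z t => pr_zero_conv _ _ _ _ _ (Or.inl fun Z t => ?_) _
    rw [← hρ, T.pr_pr_of_ne zero_ne_one]

lemma IsAction.pr_zero (hθ : IsAction θ) (f g : C.Ob) (x : T C f g) (X Y : A.Ob)
    (t : T A X Y) : T.pr 0 (θ f g x X Y t) = T.pr 0 (θ f g (T.pr 0 x) X Y t) := by
  rw [← sub_eq_zero, ← map_sub]
  refine T.pr_zero_of_counit ?_
  rw [map_sub, hθ.counit, hθ.counit, T.counit_pr_zero, sub_self]

lemma IsAction.pr_one_cons (hθ : IsAction θ) (f g h : C.Ob) (d : ℤ) (r : C.Hom f g d)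
    (x : T C g h) (X Y : A.Ob) (t : T A X Y) : T.pr 1 (θ f h (T.cons f g h d r x) X Y t) =
      T.pr 1 (θ f h (T.cons f g h d r (T.pr 0 x)) X Y t) := by
  obtain ⟨ρ, _, hρ, hcons⟩ := hθ.cons f g d r
  rw [hcons, hcons, pr_one_conv_conv (hθ.one f) hρ, pr_one_conv_conv (hθ.one f) hρ]
  congr 3
  funext Z W
  exact LinearMap.ext fun t => hθ.pr_zero _ _ _ _ _ _

/-- The component `pr₁` of `xθ` depends on `x pr₀` and `x pr₁` only. -/
lemma IsAction.pr_one (hθ : IsAction θ) (f g : C.Ob) (x : T C f g) (X Y : A.Ob)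
    (t : T A X Y) : T.pr 1 (θ f g x X Y t) =
      T.pr 1 (θ f g (T.pr 0 x) X Y t) + T.pr 1 (θ f g (T.pr 1 x) X Y t) := by
  refine T.induction (motive := fun f g x => T.pr 1 (θ f g x X Y t) =
      T.pr 1 (θ f g (T.pr 0 x) X Y t) + T.pr 1 (θ f g (T.pr 1 x) X Y t)) ?_ ?_ ?_ ?_ x
  · intro f g; simp
  · intro f g s t hs ht
    simp only [map_add, Pi.add_apply, LinearMap.add_apply, hs, ht]
    abel
  · intro f c
    simp [T.pr_succ_one 0]
  · intro f g h d r x _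
    rw [hθ.pr_one_cons, T.pr_zero_cons, T.pr_succ_cons 0]
    simp

end Action

/-! ### Compatibility of an action with differentials -/

section Defect

variable {A B C : GradedQuiver k}

lemma add_add_add_add_comm {M : Type*} [AddCommMonoid M] (a b c d e f : M) :
    a + b + (c + d) + (e + f) = a + c + e + (b + d + f) := by
  abel

lemma T.cut_combination {P : Type v} [AddCommMonoid P] [Module k P] {X Y : A.Ob} (c : k)
    (β γ δ : ∀ Z, T A X Z →ₗ[k] T A Z Y →ₗ[k] P) (t : T A X Y) :
    T.cut (fun Z => β Z + c • γ Z + c • δ Z) t =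
      T.cut β t + c • T.cut γ t + c • T.cut δ t := by
  rw [T.cut_add, T.cut_add, T.cut_smul, T.cut_smul]
  rfl

/-- `φ ↦ φb`, that is, `b ∘ φ`. -/
def postComp (b : TEnd B) (f g : A.Ob → B.Ob) : TMap A B f g →ₗ[k] TMap A B f g where
  toFun φ X Y := b (f X) (g Y) ∘ₗ φ X Y
  map_add' φ ψ := by funext X Y; exact LinearMap.comp_add _ _ _
  map_smul' c φ := by funext X Y; exact LinearMap.comp_smul _ _ _

/-- `φ ↦ bφ`, that is, `φ ∘ b`. -/
def preComp (b : TEnd A) (f g : A.Ob → B.Ob) : TMap A B f g →ₗ[k] TMap A B f g where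
  toFun φ X Y := φ X Y ∘ₗ b X Y
  map_add' φ ψ := by funext X Y; exact LinearMap.add_comp _ _ _
  map_smul' c φ := by funext X Y; exact LinearMap.smul_comp _ _ _

lemma postComp_apply (b : TEnd B) (f g : A.Ob → B.Ob) (φ : TMap A B f g) (X Y : A.Ob)
    (t : T A X Y) : postComp b f g φ X Y t = b (f X) (g Y) (φ X Y t) := rfl

lemma preComp_apply (b : TEnd A) (f g : A.Ob → B.Ob) (φ : TMap A B f g) (X Y : A.Ob)
    (t : T A X Y) : preComp b f g φ X Y t = φ X Y (b X Y t) := rfl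

/-- `1 ⊗ b + b ⊗ 1` on `⨁_Z TA ⊗ TA`, for `b` of degree 1. -/
def tensorCoder (b : TEnd A) (X Y : A.Ob) : TT A X Y →ₗ[k] TT A X Y :=
  tensorTT 0 (TEnd.one A) b X Y + tensorTT 1 b (TEnd.one A) X Y

lemma tensorTT_incl {f g h : A.Ob → B.Ob} (p : ℤ) (φ : TMap A B f g) (ψ : TMap A B g h)
    (X Y Z : A.Ob) (s : T A X Z) (t : T A Z Y) : tensorTT p φ ψ X Y (TT.incl Z (s ⊗ₜ[k] t)) =
      TT.incl (g Z) (φ X Z s ⊗ₜ[k] ψ Z Y (T.sign p t)) := by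
  simp [tensorTT, koszulTensor]

lemma tensorCoder_incl (b : TEnd A) (X Y Z : A.Ob) (s : T A X Z) (t : T A Z Y) :
    tensorCoder b X Y (TT.incl Z (s ⊗ₜ[k] t)) =
      TT.incl Z (s ⊗ₜ[k] b Z Y t) + TT.incl Z (b X Z s ⊗ₜ[k] T.sign 1 t) := by
  rw [tensorCoder, LinearMap.add_apply, tensorTT_incl, tensorTT_incl, T.sign_zero]
  rfl

/-- `(φ ⊗ ψ)(1 ⊗ b + b ⊗ 1) = φ ⊗ ψb + φb ⊗ ψ'`, where `ψ'` is `ψ` up to the sign of its degree. -/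
lemma tensorCoder_comp_tensorTT {f g h : A.Ob → B.Ob} (b : TEnd B) (d : ℤ) (φ : TMap A B f g)
    {ψ ψ' : TMap A B g h} (hψ : ∀ X Y t, T.sign 1 (ψ X Y t) = ψ' X Y (T.sign 1 t)) (X Y : A.Ob) :
    tensorCoder b (f X) (h Y) ∘ₗ tensorTT d φ ψ X Y =
      tensorTT d φ (postComp b g h ψ) X Y + tensorTT (d + 1) (postComp b f g φ) ψ' X Y := by
  refine TT.hom_ext fun Z s t => ?_
  rw [LinearMap.comp_apply, LinearMap.add_apply, tensorTT_incl, tensorTT_incl, tensorTT_incl,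
    tensorCoder_incl, hψ, T.sign_sign, add_comm 1 d]
  rfl

/-- `(1 ⊗ b + b ⊗ 1)(φ ⊗ ψ) = (-1)^d φ ⊗ bψ + bφ ⊗ ψ` for `φ` of degree `d`, where `φ ⊗ ψ` on the
left carries the sign of `φ` and `bφ ⊗ ψ` that of `bφ`. -/
lemma tensorTT_comp_tensorCoder {f g h : A.Ob → B.Ob} {b : TEnd A} (hb : HasDegree 1 b) (d : ℤ)
    (φ : TMap A B f g) (ψ : TMap A B g h) (X Y : A.Ob) :
    tensorTT d φ ψ X Y ∘ₗ tensorCoder b X Y =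
      sgn k d • tensorTT d φ (preComp b g h ψ) X Y + tensorTT (d + 1) (preComp b f g φ) ψ X Y := by
  refine TT.hom_ext fun Z s t => ?_
  rw [LinearMap.comp_apply, LinearMap.add_apply, LinearMap.smul_apply, tensorTT_incl,
    tensorTT_incl, tensorCoder_incl, map_add, tensorTT_incl, tensorTT_incl, T.sign_sign,
    preComp_apply, preComp_apply, hb.apply_sign d Z Y t, mul_one,
    map_smul, TensorProduct.tmul_smul, map_smul, smul_smul, sgn_mul_self, one_smul]

lemma TEnd.sign_one_apply {D : TEnd C} (hD : HasDegree 1 D) (f g : C.Ob) (x : T C f g) :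
    T.sign 1 (D f g x) = -D f g (T.sign 1 x) := by
  have := hD.sign_apply 1 f g x
  rwa [mul_one, sgn_one, neg_one_smul] at this

variable {obj : C.Ob → A.Ob → B.Ob} (θ : ∀ f g : C.Ob, T C f g →ₗ[k] TMap A B (obj f) (obj g))
  (bA : TEnd A) (bB : TEnd B) (D : TEnd C)

/-- The defect `(x)θb - (xD)θ - (-1)^(deg x) b(x)θ` of the compatibility of differentials with an
action `θ`. -/
def defect (f g : C.Ob) : T C f g →ₗ[k] TMap A B (obj f) (obj g) :=
  postComp bB (obj f) (obj g) ∘ₗ θ f g - θ f g ∘ₗ D f g -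
    preComp bA (obj f) (obj g) ∘ₗ θ f g ∘ₗ T.sign 1

lemma defect_apply (f g : C.Ob) (x : T C f g) : defect θ bA bB D f g x =
    postComp bB (obj f) (obj g) (θ f g x) + (-1 : k) • θ f g (D f g x) +
      (-1 : k) • preComp bA (obj f) (obj g) (θ f g (T.sign 1 x)) := by
  funext X Y
  refine LinearMap.ext fun t => ?_
  simp only [defect, LinearMap.sub_apply, Pi.sub_apply, LinearMap.comp_apply,
      Pi.add_apply, Pi.smul_apply, LinearMap.add_apply, LinearMap.smul_apply]
  rw [neg_one_smul, neg_one_smul, sub_eq_add_neg, sub_eq_add_neg]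

variable {θ bA bB D}

/-- The comultiplication of `(x)θb`. -/
lemma IsAction.comul_postComp (hθ : IsAction θ)
    (hB : IsCoderivation (TEnd.one B) (TEnd.one B) 1 bB) (f g : C.Ob) (x : T C f g) :
    (fun X Y => T.comul (obj f X) (obj g Y) ∘ₗ postComp bB _ _ (θ f g x) X Y) =
      T.cut (fun h => box 0 θ (fun f g => postComp bB (obj f) (obj g) ∘ₗ θ f g) f h g +
        box 1 (fun f g => postComp bB (obj f) (obj g) ∘ₗ θ f g) (fun f g => θ f g ∘ₗ T.sign 1)
          f h g) x := by
  let L : (∀ X Y, T A X Y →ₗ[k] TT B (obj f X) (obj g Y)) →ₗ[k]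
      (∀ X Y, T A X Y →ₗ[k] TT B (obj f X) (obj g Y)) :=
    { toFun := fun Ψ X Y => tensorCoder bB (obj f X) (obj g Y) ∘ₗ Ψ X Y
      map_add' := fun φ ψ => by funext X Y; exact LinearMap.comp_add _ _ _
      map_smul' := fun c φ => by funext X Y; exact LinearMap.comp_smul _ _ _ }
  have h1 : (fun X Y => T.comul (obj f X) (obj g Y) ∘ₗ postComp bB _ _ (θ f g x) X Y) =
      L (fun X Y => T.comul (obj f X) (obj g Y) ∘ₗ θ f g x X Y) := by
    funext X Y
    change T.comul (obj f X) (obj g Y) ∘ₗ (bB (obj f X) (obj g Y) ∘ₗ θ f g x X Y) =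
      tensorCoder bB (obj f X) (obj g Y) ∘ₗ (T.comul (obj f X) (obj g Y) ∘ₗ θ f g x X Y)
    rw [← LinearMap.comp_assoc, ← LinearMap.comp_assoc]
    exact congrArg (fun z => z ∘ₗ θ f g x X Y) (hB.comul _ _)
  rw [h1, hθ.comul, T.map_cut_apply]
  congr 2
  funext h
  refine T.hom_ext₂ fun d x y hx => ?_
  rw [LinearMap.compr₂_apply, LinearMap.add_apply, LinearMap.add_apply, box_of_mem _ _ _ hx,
    box_of_mem _ _ _ hx, box_of_mem _ _ _ hx, add_zero]
  funext X Y
  change tensorCoder bB _ _ ∘ₗ (tensorTT d (θ f h x) (θ h g y) X Y ∘ₗ T.comul X Y) = _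
  rw [← LinearMap.comp_assoc, tensorCoder_comp_tensorTT (ψ' := θ h g (T.sign 1 y)) _ _ _
    (fun X Y t => hθ.sign_apply 1 h g y X Y t), LinearMap.add_comp]
  rfl

/-- The comultiplication of `(xD)θ`. -/
lemma IsAction.comul_comp (hθ : IsAction θ)
    (hD : IsCoderivation (TEnd.one C) (TEnd.one C) 1 D) (f g : C.Ob) (x : T C f g) :
    (fun X Y => T.comul (obj f X) (obj g Y) ∘ₗ θ f g (D f g x) X Y) =
      T.cut (fun h => box 0 θ (fun f g => θ f g ∘ₗ D f g) f h g +
        box 1 (fun f g => θ f g ∘ₗ D f g) (fun f g => θ f g ∘ₗ T.sign 1) f h g) x := by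
  rw [hθ.comul, T.cut_add, LinearMap.add_apply]
  refine (cut_apply_of_comul (e := D) (hD.comul f g) (fun h => box 0 θ θ f h g) x).trans
    (congrArg₂ (· + ·) ?_ ?_)
  · refine congrArg (fun β => T.cut β x) ?_
    funext h
    refine T.hom_ext₂ fun d x y hx => ?_
    rw [LinearMap.compl₁₂_apply, LinearMap.comp_apply, T.sign_zero, LinearMap.id_apply,
      box_of_mem _ _ _ hx]
    exact box_of_mem _ _ _ hx _
  · refine congrArg (fun β => T.cut β x) ?_
    funext h
    refine T.hom_ext₂ fun d x y hx => ?_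
    rw [LinearMap.compl₁₂_apply, LinearMap.comp_apply, box_of_mem _ _ _ hx]
    refine (box_of_mem _ _ _ (hD.degree _ _ _ _ hx) _).trans ?_
    rw [add_zero]
    rfl

/-- The comultiplication of `(-1)^(deg x) b(x)θ`. -/
lemma IsAction.comul_preComp (hθ : IsAction θ)
    (hA : IsCoderivation (TEnd.one A) (TEnd.one A) 1 bA) (f g : C.Ob) (x : T C f g) :
    (fun X Y => T.comul (obj f X) (obj g Y) ∘ₗ
      preComp bA _ _ (θ f g (T.sign 1 x)) X Y) =
      T.cut (fun h => box 0 θ (fun f g => preComp bA (obj f) (obj g) ∘ₗ θ f g ∘ₗ T.sign 1) f h g +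
        box 1 (fun f g => preComp bA (obj f) (obj g) ∘ₗ θ f g ∘ₗ T.sign 1)
          (fun f g => θ f g ∘ₗ T.sign 1) f h g) x := by
  let L : (∀ X Y, T A X Y →ₗ[k] TT B (obj f X) (obj g Y)) →ₗ[k]
      (∀ X Y, T A X Y →ₗ[k] TT B (obj f X) (obj g Y)) :=
    { toFun := fun Ψ X Y => Ψ X Y ∘ₗ bA X Y
      map_add' := fun φ ψ => by funext X Y; exact LinearMap.add_comp _ _ _
      map_smul' := fun c φ => by funext X Y; exact LinearMap.smul_comp _ _ _ }
  have h1 : (fun X Y => T.comul (obj f X) (obj g Y) ∘ₗ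
      preComp bA _ _ (θ f g (T.sign 1 x)) X Y) =
      L (fun X Y => T.comul (obj f X) (obj g Y) ∘ₗ θ f g (T.sign 1 x) X Y) := rfl
  rw [h1, hθ.comul, T.cut_sign, T.map_cut_apply]
  congr 2
  funext h
  refine T.hom_ext₂ fun d x y hx => ?_
  rw [LinearMap.compr₂_apply, LinearMap.compl₁₂_apply, LinearMap.add_apply, LinearMap.add_apply,
    box_of_mem _ _ _ (T.sign_mem_deg 1 hx), box_of_mem _ _ _ hx, box_of_mem _ _ _ hx, add_zero]
  funext X Y
  change (tensorTT d (θ f h (T.sign 1 x)) (θ h g (T.sign 1 y)) X Y ∘ₗ T.comul X Y) ∘ₗ bA X Y = _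
  have hc : T.comul X Y ∘ₗ bA X Y = tensorCoder bA X Y ∘ₗ T.comul X Y := hA.comul X Y
  rw [LinearMap.comp_assoc, hc, ← LinearMap.comp_assoc, tensorTT_comp_tensorCoder hA.degree,
    LinearMap.add_comp]
  change _ = tensorTT d (θ f h x) (preComp bA (obj h) (obj g) (θ h g (T.sign 1 y))) X Y ∘ₗ
    T.comul X Y + tensorTT (d + 1) (preComp bA (obj f) (obj h) (θ f h (T.sign 1 x)))
      (θ h g (T.sign 1 y)) X Y ∘ₗ T.comul X Y
  congr 2
  -- The sign of `b` passing `(x')θ` cancels the sign of `x'` in `(-1)^(deg x)`.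
  rw [T.sign_eq_of_mem 1 hx, one_mul, map_smul, tensorTT_smul_left, smul_smul, sgn_mul_self,
    one_smul]

/-- The defect `E` is a coderivation along the action: `(x)EΔ` is the sum over the cuts `x' ⊗ x''`
of `x` of `Δ[(x')θ ⊗ (x'')E + (-1)^(deg x'') (x')E ⊗ (x'')θ]`. -/
lemma IsAction.comul_defect (hθ : IsAction θ)
    (hA : IsCoderivation (TEnd.one A) (TEnd.one A) 1 bA)
    (hB : IsCoderivation (TEnd.one B) (TEnd.one B) 1 bB)
    (hD : IsCoderivation (TEnd.one C) (TEnd.one C) 1 D) (f g : C.Ob) (x : T C f g) :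
    (fun X Y => T.comul (obj f X) (obj g Y) ∘ₗ defect θ bA bB D f g x X Y) =
      T.cut (fun h => box 0 θ (defect θ bA bB D) f h g +
        box 1 (defect θ bA bB D) (fun f g => θ f g ∘ₗ T.sign 1) f h g) x := by
  have h1 : (fun X Y => T.comul (obj f X) (obj g Y) ∘ₗ defect θ bA bB D f g x X Y) =
      (fun X Y => T.comul (obj f X) (obj g Y) ∘ₗ postComp bB _ _ (θ f g x) X Y) +
      (-1 : k) • (fun X Y => T.comul (obj f X) (obj g Y) ∘ₗ θ f g (D f g x) X Y) +
      (-1 : k) • (fun X Y => T.comul (obj f X) (obj g Y) ∘ₗ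
        preComp bA _ _ (θ f g (T.sign 1 x)) X Y) := by
    funext X Y
    rw [defect_apply]
    simp only [Pi.add_apply, Pi.smul_apply, LinearMap.comp_add, LinearMap.comp_smul]
  rw [h1, hθ.comul_postComp hB, hθ.comul_comp hD, hθ.comul_preComp hA, ← T.cut_combination]
  congr 2
  funext h
  refine T.hom_ext₂ fun d x y hx => ?_
  simp only [LinearMap.add_apply, LinearMap.smul_apply, box_of_mem _ _ _ hx, defect_apply,
    map_add, map_smul, LinearMap.comp_apply, smul_add]
  exact add_add_add_add_comm _ _ _ _ _ _

/-- An action whose defect vanishes after projection to `T¹B` is compatible with the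
differentials: by `IsAction.comul_defect`, the component `pr_{n+1}` of the defect is determined by
the components `pr₁` and `pr_n`, and the component `pr₀` is zero by counitality. -/
theorem IsAction.defect_eq_zero (hθ : IsAction θ)
    (hA : IsCoderivation (TEnd.one A) (TEnd.one A) 1 bA)
    (hB : IsCoderivation (TEnd.one B) (TEnd.one B) 1 bB)
    (hD : IsCoderivation (TEnd.one C) (TEnd.one C) 1 D)
    (h1 : ∀ f g x X Y t, T.pr 1 (defect θ bA bB D f g x X Y t) = 0) (f g : C.Ob) :
    defect θ bA bB D f g = 0 := by
  refine LinearMap.ext fun x => ?_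
  funext X Y
  refine LinearMap.ext fun t => T.eq_zero_of_pr _ fun n => ?_
  have hn : ∀ f g x X Y t, T.pr n (defect θ bA bB D f g x X Y t) = 0 := by
    induction n with
    | zero =>
      intro f g x X Y t
      refine T.pr_zero_of_counit ?_
      simp only [defect, LinearMap.sub_apply, Pi.sub_apply, LinearMap.comp_apply, map_sub,
        hθ.counit, postComp_apply, preComp_apply]
      have hB0 := counit_apply_of_comul (isCocatHom_one B) (isCocatHom_one B)
        (hB.comul (obj f X) (obj g Y)) (θ f g x X Y t)
      have hA0 := counit_apply_of_comul (isCocatHom_one A) (isCocatHom_one A) (hA.comul X Y) t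
      have hD0 := counit_apply_of_comul (isCocatHom_one C) (isCocatHom_one C) (hD.comul f g) x
      rw [hB0, hA0, hD0]
      simp
    | succ n ih =>
      intro f g x X Y t
      let L : (∀ X Y, T A X Y →ₗ[k] TT B (obj f X) (obj g Y)) →ₗ[k] T B (obj f X) (obj g Y) :=
        DirectSum.toModule k B.Ob _ (fun Z => TensorProduct.lift
          ((T.mul (obj f X) Z (obj g Y)).compl₁₂ (T.pr 1) (T.pr n))) ∘ₗ
          LinearMap.applyₗ t ∘ₗ LinearMap.proj Y ∘ₗ LinearMap.proj X
      have hL : T.pr (n + 1) (defect θ bA bB D f g x X Y t) =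
          L (fun X Y => T.comul (obj f X) (obj g Y) ∘ₗ defect θ bA bB D f g x X Y) := by
        rw [T.pr_succ_eq_cut]
        rfl
      rw [hL, hθ.comul_defect hA hB hD, T.map_cut_apply]
      convert LinearMap.zero_apply x
      convert T.cut_zero with h
      refine T.hom_ext₂ fun d x y hx => ?_
      rw [LinearMap.compr₂_apply, LinearMap.add_apply, LinearMap.add_apply, box_of_mem _ _ _ hx,
        box_of_mem _ _ _ hx, map_add]
      -- `(φ ⊗ ψ)(pr₁ ⊗ pr_n)` vanishes as soon as one of `φ pr₁` and `ψ pr_n` does.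
      have hvan : ∀ (p : ℤ) (φ : TMap A B (obj f) (obj h)) (ψ : TMap A B (obj h) (obj g)),
          ((∀ X Y t, T.pr 1 (φ X Y t) = 0) ∨ ∀ X Y t, T.pr n (ψ X Y t) = 0) →
          L (comulTensor p _ _ _ φ ψ) = 0 := by
        intro p φ ψ hφψ
        refine (comp_tensorTT_comp_comul p φ ψ X Y _ t).trans ?_
        rw [T.convolve]
        convert LinearMap.zero_apply t
        convert T.cut_zero with Z
        refine LinearMap.ext₂ fun x y => ?_
        rcases hφψ with hφ | hψ
        · simp [hφ]
        · simp [hψ]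
      rw [hvan _ _ _ (Or.inr fun X Y t => ih _ _ _ _ _ _),
        hvan _ _ _ (Or.inl fun X Y t => h1 _ _ _ _ _ _), add_zero]
      rfl
  exact hn f g x X Y t

end Defect

/-! ### Coderivations with given components, and the action of two arguments -/

section Components

variable {A B C : GradedQuiver k}

lemma hasDegree_of_incl {f g : A.Ob → B.Ob} {p : ℤ} {r : TMap A B f g}
    (h : ∀ (X Y : A.Ob) (w : Word A X Y) (t : w.tensor),
      r X Y (T.incl w t) ∈ T.deg (f X) (g Y) (w.deg + p)) : HasDegree p r := by
  intro X Y d t ht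
  refine T.incl_induction (motive := fun t => r X Y t ∈ T.deg (f X) (g Y) (d + p)) ?_ ?_ ?_ ht
  · rw [map_zero]; exact zero_mem _
  · intro s t hs ht; rw [map_add]; exact add_mem hs ht
  · rintro w t rfl
    exact h X Y w t

/-- A homogeneous element of `T¹A` of degree `d` comes from `A(X, Y)^d`. -/
lemma T.exists_pr_one_eq {X Y : A.Ob} {d : ℤ} {t : T A X Y} (ht : t ∈ T.deg X Y d) :
    ∃ a : A.Hom X Y d, T.pr 1 t = T.cons X Y Y d a (T.one Y) := by
  refine T.deg_induction (motive := fun X Y d t =>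
    ∃ a : A.Hom X Y d, T.pr 1 t = T.cons X Y Y d a (T.one Y)) ?_ ?_ ?_ ?_ ht
  · exact fun X Y d => ⟨0, by simp⟩
  · rintro X Y d s t ⟨a, ha⟩ ⟨b, hb⟩
    exact ⟨a + b, by rw [map_add, ha, hb, map_add, LinearMap.add_apply]⟩
  · exact fun X c => ⟨0, by simp [T.pr_succ_one 0]⟩
  · intro X Y Z d e a t ht _
    simp only [T.pr_succ_cons 0]
    refine T.deg_induction (motive := fun Y Z e t => ∀ a : A.Hom X Y d,
      ∃ b : A.Hom X Z (d + e), T.cons X Y Z d a (T.pr 0 t) = T.cons X Z Z (d + e) b (T.one Z))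
      ?_ ?_ ?_ ?_ ht a
    · exact fun X Y d a => ⟨0, by simp⟩
    · intro X Y d s t hs ht a
      obtain ⟨b, hb⟩ := hs a
      obtain ⟨b', hb'⟩ := ht a
      exact ⟨b + b', by rw [map_add, map_add, hb, hb', map_add, LinearMap.add_apply]⟩
    · intro Y c a
      rw [add_zero]
      exact ⟨c • a, by simp⟩
    · exact fun Y Y' Z e e' a' t _ _ a => ⟨0, by simp⟩

variable (β : ∀ (f g : C.Ob) (w : Word C f g), w.tensor →ₗ[k] C.Hom f g (w.deg + 1))

/-- The system of maps `TC → T¹C` of degree 1 with components `β`. -/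
def ofComponents : TEnd C := fun f g =>
  DirectSum.toModule k (Word C f g) (T C f g)
    (fun w => (T.cons f g g (w.deg + 1)).flip (T.one g) ∘ₗ β f g w)

lemma ofComponents_incl {f g : C.Ob} (w : Word C f g) (t : w.tensor) :
    ofComponents β f g (T.incl w t) = T.cons f g g (w.deg + 1) (β f g w t) (T.one g) := by
  simp [ofComponents]

lemma pr_one_ofComponents (f g : C.Ob) (x : T C f g) :
    T.pr 1 (ofComponents β f g x) = ofComponents β f g x := by
  induction x using DirectSum.induction_on with
  | zero => simp
  | add s t hs ht => rw [map_add, map_add, hs, ht]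
  | of w x =>
    refine (congrArg (T.pr 1) (ofComponents_incl β w x)).trans
      (Eq.trans ?_ (ofComponents_incl β w x).symm)
    rw [T.pr_succ_cons 0, T.pr_zero_one]

lemma hasDegree_ofComponents : HasDegree 1 (ofComponents β) :=
  hasDegree_of_incl fun f g w t => by
    rw [ofComponents_incl]
    have := T.cons_mem_deg f g g (β f g w t) (T.one_mem_deg g)
    rwa [add_zero] at this

/-- The `(1,1)`-coderivation of degree 1 with components `β`. -/
def coderOfComponents : TEnd C :=
  conv 0 (TEnd.one C) (conv 1 (ofComponents β) (TEnd.one C))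

lemma isCoderivation_coderOfComponents :
    IsCoderivation (TEnd.one C) (TEnd.one C) 1 (coderOfComponents β) :=
  isCoderivation_conv_conv (isCocatHom_one C) (isCocatHom_one C) (pr_one_ofComponents β)
    (hasDegree_ofComponents β)

lemma pr_one_coderOfComponents (f g : C.Ob) (x : T C f g) :
    T.pr 1 (coderOfComponents β f g x) = ofComponents β f g x :=
  pr_one_conv_conv_cocatHom (isCocatHom_one C) (isCocatHom_one C) (pr_one_ofComponents β) f g x

variable {D : TEnd C}

lemma IsCoderivation.comul_comp_self (hD : IsCoderivation (TEnd.one C) (TEnd.one C) 1 D)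
    (f g : C.Ob) : T.comul f g ∘ₗ (D f g ∘ₗ D f g) =
      (tensorTT 0 (TEnd.one C) (fun f g => D f g ∘ₗ D f g) f g +
        tensorTT 2 (fun f g => D f g ∘ₗ D f g) (TEnd.one C) f g) ∘ₗ T.comul f g := by
  have hc : T.comul f g ∘ₗ D f g = tensorCoder D f g ∘ₗ T.comul f g := hD.comul f g
  rw [← LinearMap.comp_assoc, hc, LinearMap.comp_assoc, hc, ← LinearMap.comp_assoc]
  congr 1
  refine TT.hom_ext fun Z s t => ?_
  -- The mixed terms of the square cancel because `D` is odd.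
  have h1 : T.sign 1 (D Z g t) + D Z g (T.sign 1 t) = 0 := by
    rw [TEnd.sign_one_apply hD.degree, neg_add_cancel]
  rw [LinearMap.comp_apply, LinearMap.add_apply, tensorTT_incl, tensorTT_incl, tensorCoder_incl,
    map_add, tensorCoder_incl, tensorCoder_incl, T.sign_sign, T.sign_zero]
  have h2 : TT.incl Z (D f Z s ⊗ₜ[k] T.sign 1 (D Z g t)) +
      TT.incl Z (D f Z s ⊗ₜ[k] D Z g (T.sign 1 t)) = (0 : TT C f g) := by
    rw [← map_add, ← TensorProduct.tmul_add, h1, TensorProduct.tmul_zero, map_zero]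
  rw [add_assoc, ← add_assoc (TT.incl Z (D f Z s ⊗ₜ[k] T.sign 1 (D Z g t))), h2, zero_add]
  rfl

/-- The square of a `(1,1)`-coderivation of degree 1 is determined by its component `pr₁`. -/
lemma IsCoderivation.comp_self_eq_zero (hD : IsCoderivation (TEnd.one C) (TEnd.one C) 1 D)
    (h : ∀ f g x, T.pr 1 (D f g (D f g x)) = 0) (f g : C.Ob) : D f g ∘ₗ D f g = 0 := by
  have := eq_zero_of_pr_one (isCocatHom_one C) (isCocatHom_one C) (p := 2)
    (e := fun f g => D f g ∘ₗ D f g) hD.comul_comp_self h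
  exact congrFun (congrFun this f) g

lemma IsCoderivation.pr_zero_apply (hD : IsCoderivation (TEnd.one C) (TEnd.one C) 1 D)
    (f g : C.Ob) (x : T C f g) : T.pr 0 (D f g x) = 0 :=
  T.pr_zero_of_counit (counit_apply_of_comul (isCocatHom_one C) (isCocatHom_one C) (hD.comul f g) x)

/-- A coderivation that vanishes on `1_f` after projection to `T¹C` vanishes on `1_f`. -/
lemma IsCoderivation.apply_one (hD : IsCoderivation (TEnd.one C) (TEnd.one C) 1 D) (f : C.Ob)
    (h : T.pr 1 (D f f (T.one f)) = 0) : D f f (T.one f) = 0 := by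
  refine T.eq_zero_of_pr _ fun n => ?_
  cases n with
  | zero => exact hD.pr_zero_apply _ _ _
  | succ n =>
    rw [T.pr_succ_eq_cut]
    refine (cut_apply_of_comul (e := D) (hD.comul f f) _ _).trans ?_
    rw [T.convolve, T.convolve, T.cut_one, T.cut_one]
    simp [h, TEnd.one, T.pr_succ_one 0]

end Components

section BiAction

variable {A B C : GradedQuiver k} {obj : C.Ob → A.Ob → B.Ob}

lemma T.induction_of_incl {X Y : A.Ob} {motive : T A X Y → Prop} (zero : motive 0)
    (add : ∀ s t, motive s → motive t → motive (s + t))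
    (incl : ∀ (w : Word A X Y) (t : w.tensor), motive (T.incl w t)) (t : T A X Y) : motive t :=
  DirectSum.induction_on t zero incl add

/-- The sign of the symmetry may be read off from the degree of the first factor. -/
lemma braiding_of_mem {X Y : A.Ob} {U V : C.Ob} {e : ℤ} {a : T A X Y} (ha : a ∈ T.deg X Y e)
    (c : T C U V) : braiding X Y U V (a ⊗ₜ[k] c) = T.sign e c ⊗ₜ[k] a := by
  refine T.incl_induction (motive := fun a => braiding X Y U V (a ⊗ₜ[k] c) =
    T.sign e c ⊗ₜ[k] a) ?_ ?_ ?_ ha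
  · simp
  · intro s t hs ht
    rw [TensorProduct.add_tmul, map_add, hs, ht, TensorProduct.tmul_add]
  · rintro w t rfl
    simp [braiding]

/-- The map `a ⊗ x ↦ a(xθ)` of two arguments. -/
def biAction (θ : ∀ f g : C.Ob, T C f g →ₗ[k] TMap A B (obj f) (obj g)) :
    TBiMap A C B (fun X f => obj f X) :=
  fun X Y f g => TensorProduct.lift (LinearMap.proj Y ∘ₗ LinearMap.proj X ∘ₗ θ f g).flip

variable {θ : ∀ f g : C.Ob, T C f g →ₗ[k] TMap A B (obj f) (obj g)}

/-- The comultiplication of `TA ⊗ TC` followed by `α ⊗ α`, for `α : a ⊗ x ↦ a(xθ)`, is the sum over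
the cuts `x' ⊗ x''` of `x` of the maps `Δ[(x')θ ⊗ (x'')θ]`. -/
lemma comulTensor_biAction (X Y : A.Ob) (f g : C.Ob) (a : T A X Y) (x : T C f g) :
    (biAction θ).comulTensor X Y f g (a ⊗ₜ[k] x) =
      T.cut (fun h => box 0 θ θ f h g) x X Y a := by
  -- The map `α ⊗ α` after the middle swap, as a bilinear map of the two comultiplications.
  let L : TT A X Y →ₗ[k] TT C f g →ₗ[k] TT B (obj f X) (obj g Y) :=
    TensorProduct.curry (DirectSum.toModule k (A.Ob × C.Ob) (TT B (obj f X) (obj g Y))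
      (fun Q => TT.incl (obj Q.2 Q.1) ∘ₗ
        TensorProduct.map (biAction θ X Q.1 f Q.2) (biAction θ Q.1 Y Q.2 g) ∘ₗ
        middleSwap X Q.1 Y f Q.2 g) ∘ₗ
    (TensorProduct.directSum k k (fun Z : A.Ob => T A X Z ⊗[k] T A Z Y)
      (fun W : C.Ob => T C f W ⊗[k] T C W g)).toLinearMap)
  have hL : ∀ (Z : A.Ob) (h : C.Ob) (s : T A X Z) (t : T A Z Y) (y : T C f h) (z : T C h g),
      L (TT.incl Z (s ⊗ₜ[k] t)) (TT.incl h (y ⊗ₜ[k] z)) = TT.incl (obj h Z)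
        (TensorProduct.map (biAction θ X Z f h) (biAction θ Z Y h g)
          (middleSwap X Z Y f h g ((s ⊗ₜ[k] t) ⊗ₜ[k] (y ⊗ₜ[k] z)))) := by
    intro Z h s t y z
    simp only [L, TensorProduct.curry_apply, LinearMap.comp_apply, LinearEquiv.coe_coe]
    rw [TensorProduct.directSum_lof_tmul_lof, DirectSum.toModule_lof]
    rfl
  have h1 : (biAction θ).comulTensor X Y f g (a ⊗ₜ[k] x) =
      (LinearMap.applyₗ (T.comul X Y a) ∘ₗ L.flip) (T.comul f g x) := rfl
  have h2 : T.cut (fun h => box 0 θ θ f h g) x X Y a =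
      (LinearMap.applyₗ a ∘ₗ LinearMap.proj Y ∘ₗ LinearMap.proj X)
        (T.cut (fun h => box 0 θ θ f h g) x) := rfl
  rw [h1, h2, T.comul_eq_cut f g, T.map_cut_apply, T.map_cut_apply]
  congr 2
  funext h
  refine T.hom_ext₂ fun d y z hy => ?_
  rw [LinearMap.compr₂_apply, LinearMap.compr₂_apply, LinearMap.compr₂_apply,
    box_of_mem _ _ _ hy]
  change L.flip (TT.incl h (y ⊗ₜ[k] z)) (T.comul X Y a) =
    tensorTT (d + 0) (θ f h y) (θ h g z) X Y (T.comul X Y a)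
  refine LinearMap.congr_fun (TT.hom_ext fun Z s t => ?_) _
  rw [LinearMap.flip_apply, hL, tensorTT_incl, add_zero]
  have hs : middleSwap X Z Y f h g ((s ⊗ₜ[k] t) ⊗ₜ[k] (y ⊗ₜ[k] z)) =
      (s ⊗ₜ[k] y) ⊗ₜ[k] (T.sign d t ⊗ₜ[k] z) := by
    refine T.induction_of_incl (motive := fun t =>
      middleSwap X Z Y f h g ((s ⊗ₜ[k] t) ⊗ₜ[k] (y ⊗ₜ[k] z)) =
      (s ⊗ₜ[k] y) ⊗ₜ[k] (T.sign d t ⊗ₜ[k] z)) ?_ ?_ ?_ t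
    · simp
    · intro t t' ht ht'
      simp only [TensorProduct.tmul_add, TensorProduct.add_tmul, map_add, ht, ht']
    · intro w t
      have hbr : braiding Z Y f h (T.incl w t ⊗ₜ[k] y) = y ⊗ₜ[k] T.sign d (T.incl w t) := by
        rw [braiding_of_mem (T.incl_mem_deg w t), T.sign_eq_of_mem _ hy,
          T.sign_eq_of_mem _ (T.incl_mem_deg w t), TensorProduct.smul_tmul, mul_comm]
      simp only [middleSwap, LinearMap.comp_apply, LinearEquiv.coe_coe, TensorProduct.assoc_tmul,
        LinearMap.lTensor_tmul, TensorProduct.assoc_symm_tmul, LinearMap.rTensor_tmul, hbr]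
  rw [hs]
  rfl

end BiAction

/-! ### The differential of `A∞(A, B)` -/

section Functors

variable {A B : AInfCat k}

lemma theta_one (f : (sAInf A B).Ob) : theta f f (T.one f) = AInfFunctor.map f := by
  simp [theta, T.one, Word.theta]

lemma theta_cons (f g h : (sAInf A B).Ob) (d : ℤ) (r : (sAInf A B).Hom f g d)
    (t : T (sAInf A B) g h) : theta f h (T.cons f g h d r t) =
      conv 0 (AInfFunctor.map f) (conv d (TMap.prOne (sAInf.toMap f g d r)) (theta g h t)) := by
  have : theta f h ∘ₗ T.cons f g h d r = thetaStep f g (AInfFunctor.obj h) d r ∘ₗ theta g h := by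
    refine DirectSum.linearMap_ext k fun w => ?_
    refine LinearMap.ext fun t => ?_
    simp only [LinearMap.comp_apply]
    erw [T.cons_incl]
    simp [theta, Word.theta]
  exact LinearMap.congr_fun this t

lemma sAInf.isCocatHom (f : (sAInf A B).Ob) : IsCocatHom (AInfFunctor.map f) :=
  AInfFunctor.isCocatHom f

/-- The shifts of degree in `A∞(A, B)` and in its suspension cancel. -/
lemma sAInf.mem_iff (f g : (sAInf A B).Ob) (d : ℤ)
    (r : TMap A.s B.s (AInfFunctor.obj f) (AInfFunctor.obj g)) :
    r ∈ AInfTrans (A := A) (B := B) f g (d + 1 - 1) ↔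
      IsCoderivation (AInfFunctor.map f) (AInfFunctor.map g) d r := by
  rw [show d + 1 - 1 = d by omega]
  rfl

lemma sAInf.isCoderivation (f g : (sAInf A B).Ob) (d : ℤ) (r : (sAInf A B).Hom f g d) :
    IsCoderivation (AInfFunctor.map f) (AInfFunctor.map g) d (sAInf.toMap f g d r) :=
  (sAInf.mem_iff f g d _).1 r.2

lemma isAction_theta (A B : AInfCat k) :
    IsAction (obj := fun f : (sAInf A B).Ob => AInfFunctor.obj f) (fun f g => theta f g) where
  one f := by
    rw [theta_one]
    exact sAInf.isCocatHom f
  cons f g d r := by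
    refine ⟨TMap.prOne (sAInf.toMap f g d r), (sAInf.isCoderivation f g d r).degree.prOne,
      TMap.pr_one_prOne _, fun h t => ?_⟩
    rw [theta_one, theta_cons]

/-- On `T¹sA∞(A, B)`, the component `rθ pr₁` is `r pr₁`. -/
lemma pr_one_theta_cons_one (f g : (sAInf A B).Ob) (d : ℤ) (r : (sAInf A B).Hom f g d)
    (X Y : A.s.Ob) (t : T A.s X Y) : T.pr 1 (theta f g (T.cons f g g d r (T.one g)) X Y t) =
      TMap.prOne (sAInf.toMap f g d r) X Y t := by
  rw [theta_cons, theta_one]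
  exact pr_one_conv_conv_cocatHom (sAInf.isCocatHom f) (sAInf.isCocatHom g)
    (TMap.pr_one_prOne _) X Y t

/-- A homogeneous element `x` with `xθ = 0` and `x pr₀ = 0` satisfies `x pr₁ = 0`, because an
`A∞`-transformation `r` is determined by `r pr₁`. -/
lemma pr_one_eq_zero_of_theta {f g : (sAInf A B).Ob} {d : ℤ} {x : T (sAInf A B) f g}
    (hx : x ∈ T.deg f g d) (h0 : T.pr 0 x = 0) (hθ : theta f g x = 0) : T.pr 1 x = 0 := by
  obtain ⟨r, hr⟩ := T.exists_pr_one_eq hx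
  have h1 : ∀ X Y t, TMap.prOne (sAInf.toMap f g d r) X Y t = 0 := by
    intro X Y t
    have := (isAction_theta A B).pr_one f g x X Y t
    rw [h0, hr, pr_one_theta_cons_one, hθ, map_zero] at this
    simpa using this.symm
  have h2 : sAInf.toMap f g d r = 0 :=
    eq_zero_of_pr_one (sAInf.isCocatHom f) (sAInf.isCocatHom g)
      (sAInf.isCoderivation f g d r).comul h1
  have h3 : r = 0 := Subtype.ext h2
  rw [hr, h3, map_zero, LinearMap.zero_apply]

/-- The map `ρ ↦ F * (ρ pr₁) * G`. -/
def coderOfPrOne {A B : GradedQuiver k} {f g : A.Ob → B.Ob} (F : TMap A B f f) (G : TMap A B g g)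
    (p : ℤ) : TMap A B f g →ₗ[k] TMap A B f g where
  toFun ρ := conv 0 F (conv p (TMap.prOne ρ) G)
  map_add' ρ ρ' := by
    rw [← conv_add_right, ← conv_add_left]
    congr 2
    funext X Y
    simp [TMap.prOne, LinearMap.comp_add]
  map_smul' c ρ := by
    rw [RingHom.id_apply, ← conv_smul_right, ← conv_smul_left]
    congr 2
    funext X Y
    simp [TMap.prOne, LinearMap.comp_smul]

/-- The system of maps `(x)θb - (-1)^(deg x) b(x)θ`. -/
def thetaCommutator (f g : (sAInf A B).Ob) :
    T (sAInf A B) f g →ₗ[k] TMap A.s B.s (AInfFunctor.obj f) (AInfFunctor.obj g) :=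
  postComp B.b _ _ ∘ₗ theta f g - preComp A.b _ _ ∘ₗ theta f g ∘ₗ T.sign 1

lemma hasDegree_thetaCommutator {f g : (sAInf A B).Ob} {d : ℤ} {x : T (sAInf A B) f g}
    (hx : x ∈ T.deg f g d) : HasDegree (d + 1) (thetaCommutator f g x) := by
  intro X Y e t ht
  refine sub_mem ?_ ?_
  · have := B.str.isCoderivation.degree _ _ _ _ ((isAction_theta A B).hasDegree hx X Y e t ht)
    rwa [add_assoc] at this
  · have := (isAction_theta A B).hasDegree (T.sign_mem_deg 1 hx) X Y _ _
      (A.str.isCoderivation.degree X Y e t ht)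
    rwa [add_assoc, add_comm 1 d] at this

/-- The components of the differential of `A∞(A, B)`: the `A∞`-transformation `ρ` with
`ρ pr₁ = [(x)θb - (-1)^(deg x) b(x)θ] pr₁`. -/
def differentialComponent (A B : AInfCat k) (f g : (sAInf A B).Ob) (w : Word (sAInf A B) f g) :
    w.tensor →ₗ[k] (sAInf A B).Hom f g (w.deg + 1) :=
  LinearMap.codRestrict (AInfTrans (A := A) (B := B) f g (w.deg + 1 + 1 - 1))
    (coderOfPrOne (AInfFunctor.map f) (AInfFunctor.map g) (w.deg + 1) ∘ₗ
      thetaCommutator f g ∘ₗ T.incl w)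
    (fun x => (sAInf.mem_iff f g _ _).2
      (isCoderivation_conv_conv (sAInf.isCocatHom f) (sAInf.isCocatHom g) (TMap.pr_one_prOne _)
        (hasDegree_thetaCommutator (T.incl_mem_deg w x)).prOne))

/-- The differential `B` of `TsA∞(A, B)`. -/
def differential (A B : AInfCat k) : TEnd (sAInf A B) :=
  coderOfComponents (differentialComponent A B)

/-- The component `ρ` of `(x)B` satisfies `ρ pr₁ = [(x)θb - (-1)^(deg x) b(x)θ] pr₁`. -/
lemma prOne_differentialComponent (f g : (sAInf A B).Ob) (w : Word (sAInf A B) f g) (x : w.tensor)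
    (X Y : A.s.Ob) (t : T A.s X Y) :
    TMap.prOne (sAInf.toMap f g _ (differentialComponent A B f g w x)) X Y t =
      T.pr 1 (thetaCommutator f g (T.incl w x) X Y t) :=
  pr_one_conv_conv_cocatHom (sAInf.isCocatHom f) (sAInf.isCocatHom g) (TMap.pr_one_prOne _) X Y t

lemma isCoderivation_differential (A B : AInfCat k) :
    IsCoderivation (TEnd.one _) (TEnd.one _) 1 (differential A B) :=
  isCoderivation_coderOfComponents _

lemma pr_one_theta_differential (f g : (sAInf A B).Ob) (x : T (sAInf A B) f g)
    (X Y : A.s.Ob) (t : T A.s X Y) : T.pr 1 (theta f g (differential A B f g x) X Y t) =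
      T.pr 1 (thetaCommutator f g x X Y t) := by
  have h := (isAction_theta A B).pr_one f g (differential A B f g x) X Y t
  have h1 : T.pr 1 (differential A B f g x) = ofComponents _ f g x :=
    pr_one_coderOfComponents _ f g x
  have h0 : T.pr 0 (differential A B f g x) = 0 :=
    (isCoderivation_differential A B).pr_zero_apply f g x
  rw [h0, h1] at h
  refine h.trans ?_
  rw [map_zero, Pi.zero_apply, Pi.zero_apply, LinearMap.zero_apply, map_zero, zero_add]
  refine T.induction_of_incl (motive := fun x =>
    T.pr 1 (theta f g (ofComponents (differentialComponent A B) f g x) X Y t) =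
      T.pr 1 (thetaCommutator f g x X Y t)) ?_ ?_ ?_ x
  · simp
  · intro x y hx hy
    simp only [map_add, Pi.add_apply, LinearMap.add_apply, hx, hy]
  · intro w x
    rw [ofComponents_incl, pr_one_theta_cons_one, prOne_differentialComponent]

lemma defect_theta_differential (f g : (sAInf A B).Ob) :
    defect (fun f g => theta f g) A.b B.b (differential A B) f g = 0 := by
  refine (isAction_theta A B).defect_eq_zero A.str.isCoderivation B.str.isCoderivation
    (isCoderivation_differential A B) (fun f g x X Y t => ?_) f g
  have h := pr_one_theta_differential f g x X Y t
  simp only [defect, thetaCommutator, LinearMap.sub_apply, Pi.sub_apply, map_sub,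
    LinearMap.comp_apply] at h ⊢
  rw [h]
  abel

variable {D : TEnd (sAInf A B)}

/-- Compatibility with `θ`, for arbitrary elements of `TsA∞(A, B)`. -/
lemma thetaCompatible_iff : ThetaCompatible D ↔ ∀ (f g : (sAInf A B).Ob) (x : T (sAInf A B) f g)
    (X Y : A.s.Ob) (t : T A.s X Y), B.b _ _ (theta f g x X Y t) =
      theta f g (D f g x) X Y t + theta f g (T.sign 1 x) X Y (A.b X Y t) := by
  have hsign : ∀ {f g : (sAInf A B).Ob} (w : Word (sAInf A B) f g) (r : w.tensor) (X Y : A.s.Ob)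
      (t : T A.s X Y), theta f g (T.sign 1 (T.incl w r)) X Y (A.b X Y t) =
        (Int.negOnePow w.deg • (theta f g (T.incl w r) X Y ∘ₗ A.b X Y)) t := by
    intro f g w r X Y t
    rw [T.sign_incl, one_mul, map_smul, LinearMap.smul_apply,
      negOnePow_smul (k := k) (M := T B.s _ _)]
    rfl
  constructor
  · intro h f g x X Y t
    refine T.induction_of_incl (motive := fun x => B.b _ _ (theta f g x X Y t) =
      theta f g (D f g x) X Y t + theta f g (T.sign 1 x) X Y (A.b X Y t)) ?_ ?_ ?_ x
    · simp
    · intro x y hx hy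
      simp only [map_add, Pi.add_apply, LinearMap.add_apply, hx, hy]
      abel
    · intro w r
      rw [hsign]
      exact LinearMap.congr_fun (h f g w r X Y) t
  · intro h f g w r X Y
    refine LinearMap.ext fun t => ?_
    rw [LinearMap.add_apply, ← hsign]
    exact h f g _ X Y t

lemma isThetaDifferential_differential (A B : AInfCat k) :
    IsThetaDifferential (differential A B) where
  isCoderivation := isCoderivation_differential A B
  zero f := by
    have h1 : T.pr 1 (differential A B f f (T.one f)) = ofComponents _ f f (T.one f) :=
      pr_one_coderOfComponents _ f f _
    -- `fb = bf`, as `f` is an `A∞`-functor.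
    have h2 : thetaCommutator f f (T.one f) = 0 := by
      funext X Y
      refine LinearMap.ext fun t => ?_
      have := LinearMap.congr_fun (AInfFunctor.comm (A := A) (B := B) f X Y) t
      simp only [thetaCommutator, LinearMap.sub_apply, Pi.sub_apply, LinearMap.comp_apply,
        T.sign_one, theta_one]
      exact sub_eq_zero.2 this
    have h3 : differentialComponent A B f f (Word.nil f) ((Word.tensorNil f).symm 1) = 0 := by
      refine Subtype.ext ?_
      change coderOfPrOne _ _ _ (thetaCommutator f f (T.one f)) = 0
      rw [h2, map_zero]
    rw [h1, T.one, ofComponents_incl, h3, map_zero, LinearMap.zero_apply]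
  compatible := by
    refine thetaCompatible_iff.2 fun f g x X Y t => ?_
    have h := LinearMap.congr_fun (congrFun (congrFun (LinearMap.congr_fun
      (defect_theta_differential (A := A) (B := B) f g) x) X) Y) t
    simp only [defect, LinearMap.sub_apply, Pi.sub_apply, LinearMap.comp_apply] at h
    rw [sub_sub] at h
    exact sub_eq_zero.1 h

lemma IsThetaDifferential.ext {D' : TEnd (sAInf A B)} (hD : IsThetaDifferential D)
    (hD' : IsThetaDifferential D') : D = D' := by
  refine IsCoderivation.ext (isCocatHom_one _) (isCocatHom_one _) hD.isCoderivation
    hD'.isCoderivation fun f g x => ?_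
  refine T.induction_of_incl (motive := fun x => T.pr 1 (D f g x) = T.pr 1 (D' f g x)) ?_ ?_ ?_ x
  · simp
  · intro x y hx hy
    simp only [map_add, hx, hy]
  · intro w x
    have hw := T.incl_mem_deg w x
    have hθ : theta f g (D f g (T.incl w x) - D' f g (T.incl w x)) = 0 := by
      funext X Y
      refine LinearMap.ext fun t => ?_
      have h1 := thetaCompatible_iff.1 hD.compatible f g (T.incl w x) X Y t
      rw [thetaCompatible_iff.1 hD'.compatible f g (T.incl w x) X Y t, add_left_inj] at h1
      rw [map_sub]
      exact sub_eq_zero.2 h1.symm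
    have := pr_one_eq_zero_of_theta (sub_mem (hD.isCoderivation.degree _ _ _ _ hw)
      (hD'.isCoderivation.degree _ _ _ _ hw))
      (by rw [map_sub, hD.isCoderivation.pr_zero_apply, hD'.isCoderivation.pr_zero_apply, sub_self])
      hθ
    rw [map_sub] at this
    exact sub_eq_zero.1 this

/-- `B² = 0`: compatibility with `θ`, applied twice, gives `(xB²)θ = (x)θb² - b²(x)θ = 0`. -/
lemma IsThetaDifferential.sq_zero (hD : IsThetaDifferential D) (f g : (sAInf A B).Ob) :
    D f g ∘ₗ D f g = 0 := by
  refine hD.isCoderivation.comp_self_eq_zero (fun f g x => ?_) f g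
  refine T.induction_of_incl (motive := fun x => T.pr 1 (D f g (D f g x)) = 0) ?_ ?_ ?_ x
  · simp
  · intro x y hx hy
    simp only [map_add, hx, hy, add_zero]
  · intro w x
    have hw := T.incl_mem_deg w x
    have hθ : theta f g (D f g (D f g (T.incl w x))) = 0 := by
      funext X Y
      refine LinearMap.ext fun t => ?_
      have hc := thetaCompatible_iff.1 hD.compatible f g
      have hbB : ∀ u, B.b _ _ (B.b (AInfFunctor.obj f X) (AInfFunctor.obj g Y) u) = 0 :=
        LinearMap.congr_fun (B.str.b_sq _ _)
      have hbA : A.b X Y (A.b X Y t) = 0 := LinearMap.congr_fun (A.str.b_sq X Y) t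
      have h1 := hc (D f g (T.incl w x)) X Y t
      have h2 := hc (T.incl w x) X Y t
      have h3 := hc (T.sign 1 (T.incl w x)) X Y (A.b X Y t)
      have h4 := congrArg (B.b _ _) h2
      rw [hbB, map_add, h1, h3, hbA, map_zero, add_zero,
        TEnd.sign_one_apply hD.isCoderivation.degree, map_neg] at h4
      simpa using h4.symm
    exact pr_one_eq_zero_of_theta (hD.isCoderivation.degree _ _ _ _
      (hD.isCoderivation.degree _ _ _ _ hw)) (hD.isCoderivation.pr_zero_apply _ _ _) hθ

/-- The `A∞`-structure on `A∞(A, B)` given by a differential compatible with `θ`. -/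
def IsThetaDifferential.toAInfStructure (hD : IsThetaDifferential D) :
    AInfStructure (AInfQuiver A B) where
  b := D
  isCoderivation := hD.isCoderivation
  b_sq := hD.sq_zero
  b_one f := hD.isCoderivation.apply_one f (hD.zero f)

lemma isAInfBiFunctor_action (hD : IsThetaDifferential D) :
    IsAInfBiFunctor (C := AInfCat.ofStructure hD.toAInfStructure) (action A B) where
  isCocatBiHom :=
    { degree := by
        intro X Y f g d e a x ha hx
        exact (isAction_theta A B).hasDegree hx X Y d a ha
      comul := by
        intro X Y f g
        refine TensorProduct.ext' fun a x => ?_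
        refine Eq.trans ?_ (comulTensor_biAction (θ := fun f g => theta f g) X Y f g a x).symm
        exact LinearMap.congr_fun
          (congrFun (congrFun ((isAction_theta A B).comul f g x) X) Y) a
      counit := by
        intro X Y f g a x
        exact (isAction_theta A B).counit f g x X Y a }
  comm := by
    intro X Y f g
    refine TensorProduct.ext' fun a x => ?_
    exact (thetaCompatible_iff.1 hD.compatible f g x X Y a)
  map_one := by
    intro X f
    have h := AInfFunctor.map_one (A := A) (B := B) f X
    have h1 : action A B X X f f (T.one X ⊗ₜ[k] T.one f) = AInfFunctor.map f X X (T.one X) :=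
      LinearMap.congr_fun (congrFun (congrFun (theta_one f) X) X) (T.one X)
    exact (congrArg (T.pr 0) h1).trans (h.trans h1.symm)

lemma isThetaDifferential_of_isAInfBiFunctor (S : AInfStructure (AInfQuiver A B))
    (hS : IsAInfBiFunctor (C := AInfCat.ofStructure S) (action A B)) :
    IsThetaDifferential S.b where
  isCoderivation := S.isCoderivation
  zero f := by
    refine (congrArg (T.pr 1) (S.b_one f)).trans (map_zero _)
  compatible := thetaCompatible_iff.2 fun f g x X Y t =>
    LinearMap.congr_fun (hS.comm X Y f g) (t ⊗ₜ[k] x)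

end Functors

end AInfty

end

theorem mainTheorem2 {k : Type*} [CommRing k] (A B : AInfty.AInfCat k) :
    (∃! D : AInfty.TEnd (AInfty.sAInf A B), AInfty.IsThetaDifferential D) ∧
    ∀ D : AInfty.TEnd (AInfty.sAInf A B), AInfty.IsThetaDifferential D →
      (∀ f g : (AInfty.sAInf A B).Ob, D f g ∘ₗ D f g = 0) ∧
      ∃ S : AInfty.AInfStructure (AInfty.AInfQuiver A B),
        S.b = D ∧
        AInfty.IsAInfBiFunctor (C := AInfty.AInfCat.ofStructure S) (AInfty.action A B) ∧
        ∀ S' : AInfty.AInfStructure (AInfty.AInfQuiver A B),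
          AInfty.IsAInfBiFunctor (C := AInfty.AInfCat.ofStructure S') (AInfty.action A B) →
            S' = S := by
  refine ⟨⟨AInfty.differential A B, AInfty.isThetaDifferential_differential A B,
    fun D hD => hD.ext (AInfty.isThetaDifferential_differential A B)⟩, fun D hD => ⟨hD.sq_zero,
      hD.toAInfStructure, rfl, AInfty.isAInfBiFunctor_action hD, fun S' hS' => ?_⟩⟩
  exact AInfty.AInfStructure.ext
    ((AInfty.isThetaDifferential_of_isAInfBiFunctor S' hS').ext hD)
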